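/- Let $d\ge 1$ be an integer and let $\alpha,\beta>0$ be real. For a finite non-negative Borel measure $\mu$ on $\mathbb{R}^d$ put $\widehat{\mu}(\xi)=\int e^{-2\pi i\langle x,\xi\rangle}\,d\mu(x)$ and $\|\widehat{\mu}(\xi)|\xi|^\beta\|_\infty=\sup_{\xi\in\mathbb{R}^d}|\widehat\mu(\xi)||\xi|^\beta\in[0,\infty]$. For $\mu\neq 0$ put $$C_{\alpha,\beta,d}(\mu)=\frac{\|\widehat{\mu}(\xi)|\xi|^\beta\|_\infty^{\alpha}\,\bigl(\int|x|^\alpha\,d\mu\bigr)^{\beta}}{\mu(\mathbb{R}^d)^{\alpha+\beta}}$$ if $\|\widehat{\mu}(\xi)|\xi|^\beta\|_\infty<\infty$, and $C_{\alpha,\beta,d}(\mu)=\infty$ otherwise. Let $C^*_{\alpha,\beta,d}$ be the infimum of $C_{\alpha,\beta,d}(\mu)$ over all non-zero finite non-negative Borel measures $\mu$ on $\mathbb{R}^d$. For $\lambda\ge 0$ let $\delta_{\lambda\mathbb{S}^{d-1}}$ be the uniform measure on the sphere $\{|x|=\lambda\}$ with total mass $\lambda^{d-1}\omega_{d-1}$,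 where $\omega_{d-1}$ is the surface measure of the unit sphere $\mathbb{S}^{d-1}$. Let $\mu^*\neq 0$ be a finite non-negative Borel measure on $\mathbb{R}^d$ that is radial (invariant under the orthogonal group $O(d)$) and satisfies $C_{\alpha,\beta,d}(\mu^*)=C^*_{\alpha,\beta,d}$. Then the following hold. 1. If $\beta>\frac{d-1}{2}$, then for every $\Delta>0$ there exists $\xi\in\mathbb{R}^d$ with $|\xi|>\Delta$ such that $$|\widehat{\mu^*}(\xi)||\xi|^\beta=\|\widehat{\mu^*}(\xi)|\xi|^\beta\|_\infty .\qquad(\ast)$$ 2. If $\beta\le\frac{d-1}{2}$, then $\mu^*$ is compactly supported, and at least one of the following holds: (a) for every $\Delta>0$ there exists $\xi$ with $|\xi|>\Delta$ such that $(\ast)$ holds; (b) there exist an integer $N\ge 0$ and real numbers $c_0,\dots,c_N\ge 0$ and $\lambda_0,\dots,\lambda_N\ge 0$ such that $$\mu^*=\sum_{k=0}^N c_k\,\delta_{\lambda_k\mathbb{S}^{d-1}} .$$ -/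

import Mathlib

open MeasureTheory
open scoped ENNReal NNReal

noncomputable section

/-- Fourier transform of a finite measure: `∫ exp(-2πi⟨x, ξ⟩) dμ(x)`. -/
def measureFourier {d : ℕ} (μ : Measure (EuclideanSpace ℝ (Fin d)))
    (ξ : EuclideanSpace ℝ (Fin d)) : ℂ :=
  ∫ x, Complex.exp (-2 * Real.pi * Complex.I * ((inner ℝ x ξ : ℝ) : ℂ)) ∂μ

/-- The weighted modulus `|μ̂(ξ)| |ξ|^β`. -/
def weightedFourier {d : ℕ} (β : ℝ) (μ : Measure (EuclideanSpace ℝ (Fin d)))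
    (ξ : EuclideanSpace ℝ (Fin d)) : ℝ :=
  ‖measureFourier μ ξ‖ * ‖ξ‖ ^ β

/-- The norm `‖ μ̂(ξ) |ξ|^β ‖_∞` in `[0, ∞]`. For finite `μ` and `β > 0` the function is continuous,
so its supremum is its essential supremum. -/
def weightedFourierSup {d : ℕ} (β : ℝ) (μ : Measure (EuclideanSpace ℝ (Fin d))) : ℝ≥0∞ :=
  ⨆ ξ, ENNReal.ofReal (weightedFourier β μ ξ)

/-- The moment `I_μ(|x|^α) = ∫ |x|^α dμ` in `[0, ∞]`. -/
def moment {d : ℕ} (α : ℝ) (μ : Measure (EuclideanSpace ℝ (Fin d))) : ℝ≥0∞ :=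
  ∫⁻ x, ENNReal.ofReal (‖x‖ ^ α) ∂μ

open scoped Classical in
/-- The quotient `C_{α,β,d}(μ)`, set to `∞` when `‖ μ̂(ξ) |ξ|^β ‖_∞ = ∞`. The total variation of
a non-negative measure is its total mass. -/
def uncertaintyQuotient {d : ℕ} (α β : ℝ) (μ : Measure (EuclideanSpace ℝ (Fin d))) : ℝ≥0∞ :=
  if weightedFourierSup β μ = ∞ then ∞
  else weightedFourierSup β μ ^ α * moment α μ ^ β / μ Set.univ ^ (α + β)

/-- The optimal constant `C*_{α,β,d}`: the infimum of `C_{α,β,d}(μ)` over all non-zero finite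
non-negative Borel measures on `ℝ^d`. -/
def optimalConstant (d : ℕ) (α β : ℝ) : ℝ≥0∞ :=
  ⨅ (μ : Measure (EuclideanSpace ℝ (Fin d))) (_ : IsFiniteMeasure μ) (_ : μ ≠ 0),
    uncertaintyQuotient α β μ

/-- A measure is radial if it is invariant under the orthogonal group. -/
def IsRadialMeasure {d : ℕ} (μ : Measure (EuclideanSpace ℝ (Fin d))) : Prop :=
  ∀ R : EuclideanSpace ℝ (Fin d) ≃ₗᵢ[ℝ] EuclideanSpace ℝ (Fin d), μ.map R = μ

/-- The uniform measure on the sphere `r S^{d-1}`, of total mass `r^{d-1} ω_{d-1}`: the image of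
the surface measure of the unit sphere under `u ↦ r u`, times `r^{d-1}`. -/
def sphereMeasure (d : ℕ) (r : ℝ≥0) : Measure (EuclideanSpace ℝ (Fin d)) :=
  r ^ (d - 1) • Measure.map
    (fun u : Metric.sphere (0 : EuclideanSpace ℝ (Fin d)) 1 =>
      (r : ℝ) • (u : EuclideanSpace ℝ (Fin d)))
    (volume : Measure (EuclideanSpace ℝ (Fin d))).toSphere

/-- `|μ̂(ξ)| |ξ|^β` attains its supremum at points `ξ` of arbitrarily large modulus. -/
def AttainsSupAtInfinity {d : ℕ} (β : ℝ) (μ : Measure (EuclideanSpace ℝ (Fin d))) : Prop :=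
  ∀ Δ : ℝ, 0 < Δ → ∃ ξ : EuclideanSpace ℝ (Fin d), Δ < ‖ξ‖ ∧
    weightedFourierSup β μ = ENNReal.ofReal (weightedFourier β μ ξ)

end

open Filter Topology Set

/-! ### Fourier transforms of finite measures -/

section FourierBasic

variable {d : ℕ}

local notation "E" => EuclideanSpace ℝ (Fin d)

/-! The heart is a dichotomy valid for every β > 0: either the supremum M is attained at arbitrarily
large frequencies, or the support of the extremizer meets only finitely many spheres about the
origin (`IsExtremizer.attains_or_finite_norm_support`).

Suppose the supremum is not attained for |ξ| ≥ Δ. Among measures of the same mass whose weighted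
transform is at most M, the extremizer μ minimises the moment. Mixing in a small multiple of a
competitor shows that the constraint need only be imposed on the ball of radius Δ and near infinity
(`IsExtremizer.moment_le_of_local`). Hahn–Banach then gives a Lagrange multiplier, a continuous
functional τ on C(ball, ℂ) (`IsExtremizer.exists_multiplier`), and testing against narrow Gaussians
gives complementary slackness: p|x|^α + τ(|ξ|^β e^{-2πi⟨x,ξ⟩}) is constant on the support, with p >
0 (`IsExtremizer.exists_certificate`). Along a ray the τ-term is bounded and real-analytic, because
only frequencies from a compact ball enter, whereas r^α is unbounded. Hence only finitely many radii
occur (`finite_zeros_rpow_add`).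

If β > (d-1)/2, finitely many spheres are impossible. Their ε-neighbourhood has volume O(ε), so by
Cauchy–Schwarz the pairs of points at distance less than 2ε have μ×μ-measure at least cε^{d-1}.
Parseval with a Gaussian weight bounds this measure by O(ε^{2b}) for some b with 2b > d-1
(`not_finite_norm_support_of_decay`).

If β ≤ (d-1)/2, the unit sphere has bounded weighted transform, by an energy estimate for Bessel's
equation. Removing the part of μ beyond a large radius R, of mass x, therefore raises M by O(x)
while lowering the moment by at least R^α x. This would beat the optimum unless x = 0, so the
support is compact (`IsExtremizer.isCompact_support`). In the second alternative radiality makes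
each spherical piece uniform, and Fourier decay excludes an atom at the origin
(`IsRadialMeasure.exists_eq_sum_sphereMeasure`). -/

theorem measureFourier_eq_charFun (μ : Measure E) (ξ : E) :
    measureFourier μ ξ = charFun μ ((-2 * Real.pi) • ξ) := by
  rw [measureFourier, charFun_apply]
  congr 1 with x
  rw [inner_smul_right]
  push_cast
  ring_nf

theorem continuous_measureFourier (μ : Measure E) [IsFiniteMeasure μ] :
    Continuous (measureFourier μ) := by
  simp_rw [funext (measureFourier_eq_charFun μ)]
  exact continuous_charFun.comp (continuous_const_smul _)

theorem norm_measureFourier_le (μ : Measure E) (ξ : E) :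
    ‖measureFourier μ ξ‖ ≤ μ.real univ := by
  rw [measureFourier_eq_charFun]
  exact norm_charFun_le _

theorem measureFourier_zero (μ : Measure E) : measureFourier μ 0 = μ.real univ := by
  simp [measureFourier_eq_charFun]

theorem ext_of_measureFourier {μ ν : Measure E} [IsFiniteMeasure μ] [IsFiniteMeasure ν]
    (h : ∀ ξ, measureFourier μ ξ = measureFourier ν ξ) : μ = ν := by
  refine Measure.ext_of_charFun (funext fun t => ?_)
  have h0 : (-2 * Real.pi) ≠ 0 := by simp [Real.pi_ne_zero]
  have := h ((-2 * Real.pi)⁻¹ • t)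
  simpa only [measureFourier_eq_charFun, smul_inv_smul₀ h0] using this

theorem measureFourier_map_smul (μ : Measure E) (r : ℝ) (ξ : E) :
    measureFourier (μ.map (fun x => r • x)) ξ = measureFourier μ (r • ξ) := by
  rw [measureFourier_eq_charFun, measureFourier_eq_charFun, charFun_map_smul, smul_comm]

theorem norm_exp_inner (x ξ : E) :
    ‖Complex.exp (-2 * Real.pi * Complex.I * ((inner ℝ x ξ : ℝ) : ℂ))‖ = 1 := by
  have : -2 * Real.pi * Complex.I * ((inner ℝ x ξ : ℝ) : ℂ)
      = ((-2 * Real.pi * inner ℝ x ξ : ℝ) : ℂ) * Complex.I := by push_cast; ring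
  rw [this, Complex.norm_exp_ofReal_mul_I]

theorem integrable_exp_inner (μ : Measure E) [IsFiniteMeasure μ] (ξ : E) :
    Integrable (fun x => Complex.exp (-2 * Real.pi * Complex.I * ((inner ℝ x ξ : ℝ) : ℂ))) μ := by
  refine Integrable.of_bound (C := 1) ?_ (Eventually.of_forall fun x => ?_)
  · exact Continuous.aestronglyMeasurable (by fun_prop)
  · rw [norm_exp_inner]

theorem measureFourier_add (μ ν : Measure E) [IsFiniteMeasure μ] [IsFiniteMeasure ν] (ξ : E) :
    measureFourier (μ + ν) ξ = measureFourier μ ξ + measureFourier ν ξ :=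
  integral_add_measure (integrable_exp_inner μ ξ) (integrable_exp_inner ν ξ)

theorem measureFourier_smul (c : ℝ≥0) (μ : Measure E) (ξ : E) :
    measureFourier (c • μ) ξ = (c : ℂ) * measureFourier μ ξ := by
  rw [measureFourier, integral_smul_nnreal_measure]
  simp [measureFourier, NNReal.smul_def]

theorem measureFourier_map_isometry (μ : Measure E) (R : E ≃ₗᵢ[ℝ] E) (ξ : E) :
    measureFourier (μ.map R) ξ = measureFourier μ (R.symm ξ) := by
  rw [measureFourier, integral_map R.continuous.aemeasurable
    (Continuous.aestronglyMeasurable (by fun_prop))]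
  simp_rw [LinearIsometryEquiv.inner_map_eq_flip]
  rfl

theorem exists_isometry_map_eq {x y : E} (h : ‖x‖ = ‖y‖) : ∃ R : E ≃ₗᵢ[ℝ] E, R x = y :=
  ⟨Submodule.reflection (ℝ ∙ (x - y))ᗮ, Submodule.reflection_sub h⟩

theorem IsRadialMeasure.measureFourier_eq {μ : Measure E} (hμ : IsRadialMeasure μ) {ξ η : E}
    (h : ‖ξ‖ = ‖η‖) : measureFourier μ ξ = measureFourier μ η := by
  obtain ⟨R, rfl⟩ := exists_isometry_map_eq h
  conv_rhs => rw [← hμ R]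
  simp [measureFourier_map_isometry]

/-- Fubini, since the kernel is symmetric in x and ξ. With ν Gaussian this serves as Parseval's
formula; with ν on the unit sphere it gives the radial averaging formula. -/
theorem integral_measureFourier_comm (μ ν : Measure E) [IsFiniteMeasure μ] [IsFiniteMeasure ν]
    (L : ℝ) :
    ∫ ξ, measureFourier μ (L • ξ) ∂ν = ∫ x, measureFourier ν (L • x) ∂μ := by
  simp only [measureFourier]
  rw [integral_integral_swap]
  · refine integral_congr_ae (Eventually.of_forall fun x => ?_)
    refine integral_congr_ae (Eventually.of_forall fun y => ?_)
    simp only [inner_smul_right, real_inner_comm]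
  · refine Integrable.of_bound (C := 1) ?_ (Eventually.of_forall fun x => ?_)
    · exact Continuous.aestronglyMeasurable (by unfold Function.uncurry; fun_prop)
    · exact (norm_exp_inner _ _).le

/-- The autocorrelation `μ ∗ μ(-·)`, whose Fourier transform is `|μ̂|²`. -/
theorem measureFourier_conv_neg (μ : Measure E) [IsFiniteMeasure μ] (ξ : E) :
    measureFourier (μ ∗ μ.map (fun x => (-1 : ℝ) • x)) ξ = ((‖measureFourier μ ξ‖ ^ 2 : ℝ) : ℂ) := by
  rw [measureFourier_eq_charFun, charFun_conv, charFun_map_smul, ← measureFourier_eq_charFun,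
    neg_one_smul, charFun_neg, ← measureFourier_eq_charFun, Complex.mul_conj,
    Complex.normSq_eq_norm_sq]

end FourierBasic

/-! ### The self-dual Gaussian as a weight and as a mollifier -/

section Gaussian

/-- The Gaussian probability measure `exp(-π|v|²) dv`. -/
noncomputable def gaussMeasure (d : ℕ) : Measure (EuclideanSpace ℝ (Fin d)) :=
  volume.withDensity fun v => ENNReal.ofReal (Real.exp (-Real.pi * ‖v‖ ^ 2))

variable {d : ℕ}

local notation "E" => EuclideanSpace ℝ (Fin d)

theorem gaussMeasure_eq_coe : gaussMeasure d =
    volume.withDensity fun v : E => ((Real.exp (-Real.pi * ‖v‖ ^ 2)).toNNReal : ℝ≥0∞) := rfl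

theorem measurable_gaussDensity :
    Measurable fun v : E => (Real.exp (-Real.pi * ‖v‖ ^ 2)).toNNReal := by
  fun_prop

theorem integral_gaussMeasure {F : Type*} [NormedAddCommGroup F] [NormedSpace ℝ F] (f : E → F) :
    ∫ v, f v ∂(gaussMeasure d) = ∫ v, Real.exp (-Real.pi * ‖v‖ ^ 2) • f v := by
  rw [gaussMeasure_eq_coe, integral_withDensity_eq_integral_smul measurable_gaussDensity]
  refine integral_congr_ae (Eventually.of_forall fun v => ?_)
  simp only [NNReal.smul_def]
  rw [Real.coe_toNNReal _ (Real.exp_pos _).le]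

theorem integrable_gaussMeasure_iff {F : Type*} [NormedAddCommGroup F] [NormedSpace ℝ F]
    {f : E → F} :
    Integrable f (gaussMeasure d) ↔ Integrable fun v => Real.exp (-Real.pi * ‖v‖ ^ 2) • f v := by
  rw [gaussMeasure_eq_coe, integrable_withDensity_iff_integrable_smul measurable_gaussDensity]
  refine integrable_congr (Eventually.of_forall fun v => ?_)
  simp only [NNReal.smul_def]
  rw [Real.coe_toNNReal _ (Real.exp_pos _).le]

instance : IsFiniteMeasure (gaussMeasure d) := by
  refine isFiniteMeasure_withDensity_ofReal ?_
  have := GaussianFourier.integrable_cexp_neg_mul_sq_norm_add (V := E) (b := (Real.pi : ℂ))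
    (by simpa using Real.pi_pos) 0 0
  have h2 := this.norm
  refine (h2.congr (Eventually.of_forall fun v => ?_)).2
  simp [Complex.norm_exp, ← Complex.ofReal_pow]

theorem measureFourier_gaussMeasure (ξ : E) :
    measureFourier (gaussMeasure d) ξ = ((Real.exp (-Real.pi * ‖ξ‖ ^ 2) : ℝ) : ℂ) := by
  have h := fourier_gaussian_innerProductSpace (V := E) (b := (Real.pi : ℂ))
    (by simpa using Real.pi_pos) ξ
  have hpi : (Real.pi : ℂ) ≠ 0 := by exact_mod_cast Real.pi_ne_zero
  rw [div_self hpi, Complex.one_cpow, one_mul, Real.fourier_eq'] at h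
  rw [measureFourier, integral_gaussMeasure]
  convert h using 1
  · refine integral_congr_ae (Eventually.of_forall fun v => ?_)
    simp only [Complex.real_smul, smul_eq_mul]
    push_cast
    rw [← Complex.exp_add, ← Complex.exp_add]
    ring_nf
  · push_cast
    congr 1
    field_simp

theorem gaussMeasure_real_univ : (gaussMeasure d).real univ = 1 := by
  have := measureFourier_gaussMeasure (0 : E)
  rw [measureFourier_zero] at this
  simpa using this

instance : IsProbabilityMeasure (gaussMeasure d) :=
  ⟨by
    have := gaussMeasure_real_univ (d := d)
    rwa [measureReal_def, ENNReal.toReal_eq_one_iff] at this⟩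

/-- Polar coordinates reduce this to a one-dimensional Gaussian integral. Positive exponents serve
the moments, negative ones the energy bound. -/
theorem integrable_norm_rpow_gaussMeasure [NeZero d] {a : ℝ} (ha : -(d : ℝ) < a) :
    Integrable (fun v : E => ‖v‖ ^ a) (gaussMeasure d) := by
  have : Nontrivial E := by
    apply Module.nontrivial_of_finrank_pos (R := ℝ)
    simpa using Nat.pos_of_ne_zero (NeZero.ne d)
  rw [integrable_gaussMeasure_iff]
  have := integrable_fun_norm_addHaar (volume : Measure E)
    (f := fun r => Real.exp (-Real.pi * r ^ 2) • r ^ a)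
  rw [this]
  have h1 := (integrable_rpow_mul_exp_neg_mul_sq Real.pi_pos
    (s := a + (d - 1 : ℝ)) (by linarith)).integrableOn (s := Ioi 0)
  refine h1.congr_fun (fun r hr => ?_) measurableSet_Ioi
  have hr : 0 < r := hr
  simp only [smul_eq_mul]
  rw [Real.rpow_add hr]
  have h3 : r ^ ((d : ℝ) - 1) = r ^ (Module.finrank ℝ E - 1) := by
    rw [← Real.rpow_natCast, finrank_euclideanSpace_fin,
      Nat.cast_sub (Nat.one_le_iff_ne_zero.mpr (NeZero.ne d)), Nat.cast_one]
  rw [h3]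
  ring

/-- The Fourier energy identity for the Gaussian weight. -/
theorem integral_norm_sq_measureFourier_gauss (μ : Measure E) [IsFiniteMeasure μ] (L : ℝ) :
    ∫ v, ‖measureFourier μ (L • v)‖ ^ 2 ∂(gaussMeasure d) =
      ∫ z, Real.exp (-Real.pi * ‖L • z‖ ^ 2) ∂(μ ∗ μ.map (fun x => (-1 : ℝ) • x)) := by
  have h := integral_measureFourier_comm (μ ∗ μ.map (fun x => (-1 : ℝ) • x)) (gaussMeasure d) L
  simp_rw [measureFourier_conv_neg, measureFourier_gaussMeasure] at h
  rw [integral_complex_ofReal, integral_complex_ofReal] at h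
  exact_mod_cast h

theorem integral_measureFourier_gauss (μ : Measure E) [IsFiniteMeasure μ] (L : ℝ) :
    ∫ v, measureFourier μ (L • v) ∂(gaussMeasure d) =
      ((∫ z, Real.exp (-Real.pi * ‖L • z‖ ^ 2) ∂μ : ℝ) : ℂ) := by
  rw [integral_measureFourier_comm]
  simp_rw [measureFourier_gaussMeasure]
  exact integral_complex_ofReal

end Gaussian

/-! ### Reduction of extremality to a real-valued minimisation -/

section Optimality

variable {d : ℕ}

local notation "E" => EuclideanSpace ℝ (Fin d)

theorem weightedFourier_nonneg (β : ℝ) (μ : Measure E) (ξ : E) : 0 ≤ weightedFourier β μ ξ := by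
  unfold weightedFourier
  positivity

theorem continuous_weightedFourier {β : ℝ} (hβ : 0 < β) (μ : Measure E) [IsFiniteMeasure μ] :
    Continuous (weightedFourier β μ) :=
  (continuous_measureFourier μ).norm.mul (continuous_norm.rpow_const fun _ => Or.inr hβ.le)

theorem weightedFourierSup_le {β M : ℝ} {μ : Measure E} (h : ∀ ξ, weightedFourier β μ ξ ≤ M) :
    weightedFourierSup β μ ≤ ENNReal.ofReal M :=
  iSup_le fun ξ => ENNReal.ofReal_le_ofReal (h ξ)

theorem moment_eq_ofReal {α : ℝ} {μ : Measure E} (h : Integrable (fun x => ‖x‖ ^ α) μ) :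
    moment α μ = ENNReal.ofReal (∫ x, ‖x‖ ^ α ∂μ) :=
  (ofReal_integral_eq_lintegral_ofReal h (Eventually.of_forall fun x => by positivity)).symm

theorem integrable_of_moment_ne_top {α : ℝ} (hα : 0 < α) {μ : Measure E} (h : moment α μ ≠ ∞) :
    Integrable (fun x => ‖x‖ ^ α) μ := by
  refine (lintegral_ofReal_ne_top_iff_integrable ?_ (Eventually.of_forall fun x => ?_)).1 h
  · exact (continuous_norm.rpow_const fun _ => Or.inr hα.le).aestronglyMeasurable
  · simp only [Pi.zero_apply]
    positivity

theorem uncertaintyQuotient_eq_ofReal {α β M : ℝ} (hα : 0 < α) (hβ : 0 < β) (hM : 0 ≤ M)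
    {μ : Measure E} [IsFiniteMeasure μ] (hμ : μ ≠ 0)
    (hI : Integrable (fun x => ‖x‖ ^ α) μ) :
    ENNReal.ofReal M ^ α * moment α μ ^ β / μ univ ^ (α + β) =
      ENNReal.ofReal (M ^ α * (∫ x, ‖x‖ ^ α ∂μ) ^ β / μ.real univ ^ (α + β)) := by
  have hm : 0 < μ.real univ := by
    simpa [measureReal_def, ENNReal.toReal_pos_iff, pos_iff_ne_zero] using hμ
  have hI0 : 0 ≤ ∫ x, ‖x‖ ^ α ∂μ := integral_nonneg fun x => by positivity
  rw [moment_eq_ofReal hI, ← ofReal_measureReal (μ := μ) (s := univ),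
    ENNReal.ofReal_rpow_of_nonneg hM hα.le, ENNReal.ofReal_rpow_of_nonneg hI0 hβ.le,
    ENNReal.ofReal_rpow_of_nonneg hm.le (by positivity), ← ENNReal.ofReal_mul (by positivity),
    ← ENNReal.ofReal_div_of_pos (by positivity)]

theorem uncertaintyQuotient_le {α β M : ℝ} (hα : 0 < α) (hβ : 0 < β) (hM : 0 ≤ M)
    {μ : Measure E} [IsFiniteMeasure μ] (hμ : μ ≠ 0) (hs : ∀ ξ, weightedFourier β μ ξ ≤ M)
    (hI : Integrable (fun x => ‖x‖ ^ α) μ) :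
    uncertaintyQuotient α β μ ≤
      ENNReal.ofReal (M ^ α * (∫ x, ‖x‖ ^ α ∂μ) ^ β / μ.real univ ^ (α + β)) := by
  have hle := weightedFourierSup_le hs
  rw [uncertaintyQuotient, if_neg (ne_top_of_le_ne_top ENNReal.ofReal_ne_top hle),
    ← uncertaintyQuotient_eq_ofReal hα hβ hM hμ hI]
  gcongr

theorem tendsto_rpow_mul_exp_neg_sq (β : ℝ) {b : ℝ} (hb : 0 < b) :
    Tendsto (fun r : ℝ => Real.exp (-b * r ^ 2) * r ^ β) atTop (𝓝 0) := by
  have h := tendsto_rpow_mul_exp_neg_mul_atTop_nhds_zero β b hb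
  refine squeeze_zero' ?_ ?_ h
  · filter_upwards [eventually_ge_atTop 0] with r hr
    positivity
  · filter_upwards [eventually_ge_atTop 1] with r hr
    rw [mul_comm]
    refine mul_le_mul_of_nonneg_left (Real.exp_le_exp.2 ?_) (by positivity)
    nlinarith [mul_nonneg hb.le (mul_nonneg (zero_le_one.trans hr) (sub_nonneg.2 hr))]

/-- Fourier decay of the Gaussian, dilated and translated. -/
theorem norm_measureFourier_gauss_affine (x : E) (ε : ℝ) (ξ : E) :
    ‖measureFourier ((gaussMeasure d).map fun v => x + ε • v) ξ‖ =
      Real.exp (-Real.pi * (ε * ‖ξ‖) ^ 2) := by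
  have : (gaussMeasure d).map (fun v => x + ε • v) =
      ((gaussMeasure d).map (fun v => ε • v)).map (fun v => x + v) := by
    rw [Measure.map_map (by fun_prop) (by fun_prop)]
    rfl
  rw [this, measureFourier_eq_charFun, charFun_map_const_add, ← measureFourier_eq_charFun,
    measureFourier_map_smul, measureFourier_gaussMeasure, norm_mul, Complex.norm_exp_ofReal_mul_I,
    Complex.norm_real, Real.norm_eq_abs, Real.abs_exp, norm_smul, mul_pow, mul_pow,
    Real.norm_eq_abs, sq_abs]
  simp

theorem weightedFourier_gauss_bounded {β : ℝ} (hβ : 0 < β) :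
    ∃ M, 0 ≤ M ∧ ∀ ξ : E, weightedFourier β (gaussMeasure d) ξ ≤ M := by
  have h := tendsto_rpow_mul_exp_neg_sq β Real.pi_pos
  obtain ⟨R, hR⟩ := (eventually_atTop.1 (h.eventually (eventually_le_nhds zero_lt_one)))
  refine ⟨max 1 ((max R 0) ^ β), by positivity, fun ξ => ?_⟩
  have h1 : weightedFourier β (gaussMeasure d) ξ =
      Real.exp (-Real.pi * ‖ξ‖ ^ 2) * ‖ξ‖ ^ β := by
    rw [weightedFourier, measureFourier_gaussMeasure, Complex.norm_real, Real.norm_eq_abs,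
      Real.abs_exp]
  rw [h1]
  rcases le_total R ‖ξ‖ with hξ | hξ
  · exact (hR _ hξ).trans (le_max_left _ _)
  · refine le_trans ?_ (le_max_right _ _)
    rw [← one_mul (max R 0 ^ β)]
    gcongr
    · rw [Real.exp_le_one_iff]
      have := Real.pi_pos
      nlinarith [sq_nonneg ‖ξ‖]
    · exact hξ.trans (le_max_left _ _)

theorem optimalConstant_ne_top [NeZero d] {α β : ℝ} (hα : 0 < α) (hβ : 0 < β) :
    optimalConstant d α β ≠ ∞ := by
  obtain ⟨M, hM, hs⟩ := weightedFourier_gauss_bounded (d := d) hβ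
  have h0 : gaussMeasure d ≠ 0 := IsProbabilityMeasure.ne_zero _
  have := uncertaintyQuotient_le hα hβ hM h0 hs
    (integrable_norm_rpow_gaussMeasure (by have := Nat.cast_nonneg (α := ℝ) d; linarith))
  refine ne_top_of_le_ne_top (ne_top_of_le_ne_top ENNReal.ofReal_ne_top this) ?_
  exact iInf_le_of_le _ (iInf_le_of_le inferInstance (iInf_le _ h0))

/-- The data of an extremizer `μ`, with real-valued supremum `M`, moment and mass. -/
structure IsExtremizer (α β M : ℝ) (μ : Measure E) : Prop where
  sup_pos : 0 < M
  sup_eq : weightedFourierSup β μ = ENNReal.ofReal M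
  le_sup : ∀ ξ, weightedFourier β μ ξ ≤ M
  integrable : Integrable (fun x => ‖x‖ ^ α) μ
  moment_pos : 0 < ∫ x, ‖x‖ ^ α ∂μ
  mass_pos : 0 < μ.real univ
  optimal : ∀ (ν : Measure E) [IsFiniteMeasure ν], ν ≠ 0 → ∀ M' : ℝ, 0 ≤ M' →
    (∀ ξ, weightedFourier β ν ξ ≤ M') → Integrable (fun x => ‖x‖ ^ α) ν →
    M ^ α * (∫ x, ‖x‖ ^ α ∂μ) ^ β / μ.real univ ^ (α + β) ≤
      M' ^ α * (∫ x, ‖x‖ ^ α ∂ν) ^ β / ν.real univ ^ (α + β)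

theorem exists_unit_vector [NeZero d] : ∃ e : E, ‖e‖ = 1 :=
  ⟨EuclideanSpace.single (0 : Fin d) (1 : ℝ), by simp⟩

/-- Otherwise the transform would vanish along a ray, and by continuity also at 0, where it equals
the total mass. -/
theorem sup_pos_of_ne_zero [NeZero d] {β M : ℝ} {μ : Measure E} [IsFiniteMeasure μ]
    (hm : 0 < μ.real univ) (hs : ∀ ξ, weightedFourier β μ ξ ≤ M) : 0 < M := by
  obtain ⟨e, he⟩ := exists_unit_vector (d := d)
  by_contra hM
  have hz : ∀ t : ℝ, 0 < t → measureFourier μ (t • e) = 0 := by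
    intro t ht
    have h1 := (hs (t • e)).trans (not_lt.1 hM)
    have h2 : 0 < ‖t • e‖ ^ β := by
      rw [norm_smul, he, mul_one, Real.norm_eq_abs, abs_of_pos ht]
      positivity
    have h3 : ‖measureFourier μ (t • e)‖ ≤ 0 := by
      by_contra hc
      exact absurd h1 (not_le.2 (mul_pos (not_le.1 hc) h2))
    exact norm_le_zero_iff.1 h3
  have hc : Tendsto (fun t : ℝ => measureFourier μ (t • e)) (𝓝[>] 0)
      (𝓝 (measureFourier μ ((0 : ℝ) • e))) :=
    (((continuous_measureFourier μ).comp (by fun_prop :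
      Continuous fun t : ℝ => t • e)).tendsto 0).mono_left nhdsWithin_le_nhds
  have h0 : Tendsto (fun t : ℝ => measureFourier μ (t • e)) (𝓝[>] 0) (𝓝 0) :=
    tendsto_const_nhds.congr' (by
      filter_upwards [self_mem_nhdsWithin] with t ht
      exact (hz t ht).symm)
  have := tendsto_nhds_unique hc h0
  rw [zero_smul, measureFourier_zero] at this
  exact hm.ne' (by exact_mod_cast this)

/-- A zero moment concentrates the measure at the origin. Its transform is then a non-zero constant,
and the weight |ξ|^β makes it unbounded. -/
theorem moment_pos_of_bounded [NeZero d] {α β M : ℝ} (hα : 0 < α) (hβ : 0 < β)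
    {μ : Measure E} [IsFiniteMeasure μ]
    (hm : 0 < μ.real univ) (hs : ∀ ξ, weightedFourier β μ ξ ≤ M)
    (hI : Integrable (fun x => ‖x‖ ^ α) μ) : 0 < ∫ x, ‖x‖ ^ α ∂μ := by
  obtain ⟨e, he⟩ := exists_unit_vector (d := d)
  refine lt_of_le_of_ne (integral_nonneg fun x => by positivity) fun h0 => ?_
  have h1 := (integral_eq_zero_iff_of_nonneg (fun x => by positivity) hI).1 h0.symm
  have h2 : ∀ ξ, measureFourier μ ξ = μ.real univ := by
    intro ξ
    rw [measureFourier, ← measureFourier_zero]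
    refine integral_congr_ae ?_
    filter_upwards [h1] with x hx
    have hx0 : x = 0 := by
      simpa [Real.rpow_eq_zero (norm_nonneg x) hα.ne'] using hx
    simp [hx0]
  have h3 : Tendsto (fun t : ℝ => μ.real univ * t ^ β) atTop atTop :=
    (tendsto_rpow_atTop hβ).const_mul_atTop hm
  obtain ⟨t, ht, ht0⟩ := ((h3.eventually_gt_atTop M).and (eventually_gt_atTop 0)).exists
  have h4 := hs (t • e)
  rw [weightedFourier, h2, norm_smul, he, mul_one, Real.norm_eq_abs, abs_of_pos ht0,
    Complex.norm_real, Real.norm_eq_abs, abs_of_pos hm] at h4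
  linarith

theorem exists_isExtremizer [NeZero d] {α β : ℝ} (hα : 0 < α) (hβ : 0 < β) {μ : Measure E}
    [IsFiniteMeasure μ] (hμ : μ ≠ 0) (hext : uncertaintyQuotient α β μ = optimalConstant d α β) :
    ∃ M, IsExtremizer α β M μ := by
  have hm : 0 < μ.real univ := by
    simpa [measureReal_def, ENNReal.toReal_pos_iff, pos_iff_ne_zero] using hμ
  have hfin : uncertaintyQuotient α β μ ≠ ∞ := hext ▸ optimalConstant_ne_top hα hβ
  have hsup : weightedFourierSup β μ ≠ ∞ := by
    intro h
    exact hfin (by rw [uncertaintyQuotient, if_pos h])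
  set M := (weightedFourierSup β μ).toReal with hMdef
  have hsM : weightedFourierSup β μ = ENNReal.ofReal M := (ENNReal.ofReal_toReal hsup).symm
  have hle : ∀ ξ, weightedFourier β μ ξ ≤ M := by
    intro ξ
    refine (ENNReal.ofReal_le_ofReal_iff ENNReal.toReal_nonneg).1 ?_
    rw [← hsM]
    exact le_iSup (fun ξ => ENNReal.ofReal (weightedFourier β μ ξ)) ξ
  have hM := sup_pos_of_ne_zero hm hle
  have hquot : uncertaintyQuotient α β μ =
      ENNReal.ofReal M ^ α * moment α μ ^ β / μ univ ^ (α + β) := by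
    rw [uncertaintyQuotient, if_neg hsup, hsM]
  -- Since M > 0, an infinite moment would make the whole quotient infinite, while the Gaussian
  -- shows that the optimal constant is finite.
  have hmom : moment α μ ≠ ∞ := by
    intro h
    apply hfin
    rw [hquot, h, ENNReal.top_rpow_of_pos hβ, ENNReal.mul_top, ENNReal.top_div_of_ne_top]
    · exact ENNReal.rpow_ne_top_of_nonneg (by positivity) (measure_ne_top _ _)
    · exact (ENNReal.rpow_pos (ENNReal.ofReal_pos.2 hM) ENNReal.ofReal_ne_top).ne'
  have hI := integrable_of_moment_ne_top hα hmom
  refine ⟨M, hM, hsM, hle, hI, moment_pos_of_bounded hα hβ hm hle hI, hm, ?_⟩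
  intro ν _ hν M' hM' hs' hI'
  have h1 : uncertaintyQuotient α β μ ≤ uncertaintyQuotient α β ν := by
    rw [hext]
    exact iInf_le_of_le _ (iInf_le_of_le inferInstance (iInf_le _ hν))
  have h2 := h1.trans (uncertaintyQuotient_le hα hβ hM' hν hs' hI')
  rw [hquot, uncertaintyQuotient_eq_ofReal hα hβ hM.le hμ hI] at h2
  refine (ENNReal.ofReal_le_ofReal_iff ?_).1 h2
  have : 0 ≤ ∫ x, ‖x‖ ^ α ∂ν := integral_nonneg fun x => by positivity
  positivity

/-- With the mass and the bound M fixed, the moment is the only factor of the quotient left to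
compare. -/
theorem IsExtremizer.moment_le {α β M : ℝ} (hβ : 0 < β) {μ : Measure E}
    (h : IsExtremizer α β M μ) {ν : Measure E} [IsFiniteMeasure ν]
    (hmass : ν.real univ = μ.real univ) (hs : ∀ ξ, weightedFourier β ν ξ ≤ M)
    (hI : Integrable (fun x => ‖x‖ ^ α) ν) : ∫ x, ‖x‖ ^ α ∂μ ≤ ∫ x, ‖x‖ ^ α ∂ν := by
  have hm := h.mass_pos
  have hν : ν ≠ 0 := by
    rintro rfl
    simp at hmass
    linarith
  have h1 := h.optimal ν hν M h.sup_pos.le hs hI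
  rw [hmass] at h1
  have hM := h.sup_pos
  rw [div_le_div_iff_of_pos_right (by positivity), mul_le_mul_iff_right₀ (by positivity)] at h1
  exact (Real.rpow_le_rpow_iff h.moment_pos.le (integral_nonneg fun x => by positivity) hβ).1 h1

end Optimality

/-! ### Localising the constraint by convex combinations -/

section Mixing

variable {d : ℕ}

local notation "E" => EuclideanSpace ℝ (Fin d)

theorem weightedFourier_mix_le (β : ℝ) (μ ν : Measure E) [IsFiniteMeasure μ] [IsFiniteMeasure ν]
    (s t : ℝ≥0) (ξ : E) :
    weightedFourier β (s • μ + t • ν) ξ ≤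
      s * weightedFourier β μ ξ + t * weightedFourier β ν ξ := by
  simp only [weightedFourier, measureFourier_add, measureFourier_smul]
  rw [← mul_assoc, ← mul_assoc, ← add_mul]
  refine mul_le_mul_of_nonneg_right ((norm_add_le _ _).trans_eq ?_) (by positivity)
  simp

theorem integral_mix {F : Type*} [NormedAddCommGroup F] [NormedSpace ℝ F] {μ ν : Measure E}
    {f : E → F} (hμ : Integrable f μ) (hν : Integrable f ν) (s t : ℝ≥0) :
    ∫ x, f x ∂(s • μ + t • ν) = (s : ℝ) • ∫ x, f x ∂μ + (t : ℝ) • ∫ x, f x ∂ν := by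
  rw [integral_add_measure hμ.smul_measure_nnreal hν.smul_measure_nnreal,
    integral_smul_nnreal_measure, integral_smul_nnreal_measure]
  rfl

theorem real_univ_mix (μ ν : Measure E) [IsFiniteMeasure μ] [IsFiniteMeasure ν] (s t : ℝ≥0) :
    (s • μ + t • ν).real univ = s * μ.real univ + t * ν.real univ := by
  rw [measureReal_add_apply, measureReal_nnreal_smul_apply, measureReal_nnreal_smul_apply]

/-- If the supremum is not attained outside the ball of radius `Δ`, then the moment is minimal among
competitors constrained only on that ball and near infinity. -/
theorem IsExtremizer.moment_le_of_local {α β M Δ : ℝ} (hβ : 0 < β) {μ : Measure E}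
    [IsFiniteMeasure μ] (h : IsExtremizer α β M μ)
    (hΔ : ∀ ξ, Δ ≤ ‖ξ‖ → weightedFourier β μ ξ < M) {ν : Measure E} [IsFiniteMeasure ν]
    (hmass : ν.real univ = μ.real univ) (hI : Integrable (fun x => ‖x‖ ^ α) ν)
    (hlarge : ∃ Δ', ∀ ξ, Δ' < ‖ξ‖ → weightedFourier β ν ξ ≤ M)
    (hsmall : ∀ ξ, ‖ξ‖ ≤ Δ → weightedFourier β ν ξ ≤ M) :
    ∫ x, ‖x‖ ^ α ∂μ ≤ ∫ x, ‖x‖ ^ α ∂ν := by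
  obtain ⟨Δ', hΔ'⟩ := hlarge
  have hM := h.sup_pos
  -- On the compact annulus where ν is unconstrained, μ stays below M by a uniform margin.
  obtain ⟨δ, hδ, hmid⟩ : ∃ δ, 0 < δ ∧ ∀ ξ : E, Δ ≤ ‖ξ‖ → ‖ξ‖ ≤ Δ' →
      weightedFourier β μ ξ ≤ M - δ := by
    have hK : IsCompact {ξ : E | Δ ≤ ‖ξ‖ ∧ ‖ξ‖ ≤ Δ'} := by
      refine (isCompact_closedBall (0 : E) Δ').of_isClosed_subset ?_ fun ξ hξ => by
        simpa using hξ.2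
      exact (isClosed_le continuous_const continuous_norm).inter
        (isClosed_le continuous_norm continuous_const)
    rcases Set.eq_empty_or_nonempty {ξ : E | Δ ≤ ‖ξ‖ ∧ ‖ξ‖ ≤ Δ'} with he | hne
    · exact ⟨1, one_pos, fun ξ h1 h2 => absurd (show ξ ∈ (∅ : Set E) from he ▸ ⟨h1, h2⟩)
        (Set.notMem_empty ξ)⟩
    · obtain ⟨ξ₀, hξ₀, hmax⟩ :=
        hK.exists_isMaxOn hne (continuous_weightedFourier hβ μ).continuousOn
      refine ⟨M - weightedFourier β μ ξ₀, sub_pos.2 (hΔ _ hξ₀.1), fun ξ h1 h2 => ?_⟩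
      rw [sub_sub_cancel]
      exact hmax ⟨h1, h2⟩
  set C := ν.real univ * (max Δ' 0) ^ β with hC
  have hC0 : 0 ≤ C := by positivity
  have hνC : ∀ ξ, ‖ξ‖ ≤ Δ' → weightedFourier β ν ξ ≤ C := by
    intro ξ hξ
    rw [weightedFourier, hC]
    gcongr
    · exact norm_measureFourier_le ν ξ
    · exact hξ.trans (le_max_left _ _)
  -- Chosen so that on the annulus (1 - t)(M - δ) + tC = M - tM ≤ M.
  set t : ℝ := δ / (δ + C) with ht
  have ht0 : 0 < t := by positivity
  have ht1 : t ≤ 1 := (div_le_one (by positivity)).2 (by linarith)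
  have htC : t * (δ + C) = δ := div_mul_cancel₀ _ (by positivity)
  set t' : ℝ≥0 := ⟨t, ht0.le⟩ with ht'
  set s' : ℝ≥0 := ⟨1 - t, sub_nonneg.2 ht1⟩ with hs'
  have hbound : ∀ ξ, weightedFourier β (s' • μ + t' • ν) ξ ≤ M := by
    intro ξ
    refine (weightedFourier_mix_le β μ ν s' t' ξ).trans ?_
    change (1 - t) * _ + t * _ ≤ M
    have hμ1 := h.le_sup ξ
    have hcomb : weightedFourier β ν ξ ≤ M →
        (1 - t) * weightedFourier β μ ξ + t * weightedFourier β ν ξ ≤ M := by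
      intro h1
      nlinarith [mul_le_mul_of_nonneg_left hμ1 (sub_nonneg.2 ht1),
        mul_le_mul_of_nonneg_left h1 ht0.le]
    rcases le_or_gt ‖ξ‖ Δ with h1 | h1
    · exact hcomb (hsmall ξ h1)
    rcases le_or_gt ‖ξ‖ Δ' with h2 | h2
    · nlinarith [mul_le_mul_of_nonneg_left (hmid ξ h1.le h2) (sub_nonneg.2 ht1),
        mul_le_mul_of_nonneg_left (hνC ξ h2) ht0.le, mul_pos ht0 hM]
    · exact hcomb (hΔ' ξ h2)
  have hle := h.moment_le hβ (ν := s' • μ + t' • ν)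
    (by
      rw [real_univ_mix, hmass, ← add_mul]
      change (1 - t + t) * _ = _
      ring)
    hbound (Integrable.add_measure h.integrable.smul_measure_nnreal hI.smul_measure_nnreal)
  rw [integral_mix h.integrable hI] at hle
  change _ ≤ (1 - t) * _ + t * _ at hle
  have : t * ∫ x, ‖x‖ ^ α ∂μ ≤ t * ∫ x, ‖x‖ ^ α ∂ν := by linarith
  exact le_of_mul_le_mul_left this ht0

end Mixing

/-! ### Weighted characters as vectors in C(ball, ℂ) -/

section Kernel

variable {d : ℕ}

local notation "E" => EuclideanSpace ℝ (Fin d)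

/-- The function `ξ ↦ |ξ|^β exp(-2πi⟨x, ξ⟩)` on the closed ball of radius `Δ`. -/
noncomputable def weightedChar {β : ℝ} (hβ : 0 < β) (Δ : ℝ) (x : E) :
    C(Metric.closedBall (0 : E) Δ, ℂ) where
  toFun ξ := ((‖(ξ : E)‖ ^ β : ℝ) : ℂ) *
    Complex.exp (-2 * Real.pi * Complex.I * ((inner ℝ x (ξ : E) : ℝ) : ℂ))
  continuous_toFun := by
    refine Continuous.mul ?_ (by fun_prop)
    exact Complex.continuous_ofReal.comp
      ((continuous_norm.comp continuous_subtype_val).rpow_const fun _ => Or.inr hβ.le)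

theorem weightedChar_apply {β : ℝ} (hβ : 0 < β) (Δ : ℝ) (x : E)
    (ξ : Metric.closedBall (0 : E) Δ) : weightedChar hβ Δ x ξ = ((‖(ξ : E)‖ ^ β : ℝ) : ℂ) *
    Complex.exp (-2 * Real.pi * Complex.I * ((inner ℝ x (ξ : E) : ℝ) : ℂ)) := rfl

theorem continuous_weightedChar {β : ℝ} (hβ : 0 < β) (Δ : ℝ) :
    Continuous (weightedChar (d := d) hβ Δ) := by
  refine ContinuousMap.continuous_of_continuous_uncurry _ ?_
  unfold Function.uncurry
  simp only [weightedChar_apply]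
  refine Continuous.mul ?_ (by fun_prop)
  exact Complex.continuous_ofReal.comp
    ((continuous_norm.comp (continuous_subtype_val.comp continuous_snd)).rpow_const
      fun _ => Or.inr hβ.le)

theorem norm_weightedChar_le {β : ℝ} (hβ : 0 < β) {Δ : ℝ} (hΔ : 0 ≤ Δ) (x : E) :
    ‖weightedChar hβ Δ x‖ ≤ Δ ^ β := by
  refine (ContinuousMap.norm_le _ (by positivity)).2 fun ξ => ?_
  rw [weightedChar_apply, norm_mul, norm_exp_inner, mul_one, Complex.norm_real,
    Real.norm_of_nonneg (by positivity)]
  have := mem_closedBall_zero_iff.1 ξ.2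
  gcongr

theorem integrable_weightedChar {β : ℝ} (hβ : 0 < β) {Δ : ℝ} (hΔ : 0 ≤ Δ) (μ : Measure E)
    [IsFiniteMeasure μ] : Integrable (weightedChar hβ Δ) μ :=
  Integrable.of_bound (continuous_weightedChar hβ Δ).aestronglyMeasurable (Δ ^ β)
    (Eventually.of_forall fun x => norm_weightedChar_le hβ hΔ x)

/-- This turns the Fourier constraint on the ball into a sup-norm bound on one Bochner integral,
which is affine in the measure. -/
theorem norm_integral_weightedChar_apply {β : ℝ} (hβ : 0 < β) {Δ : ℝ} (hΔ : 0 ≤ Δ) (μ : Measure E)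
    [IsFiniteMeasure μ] (ξ : Metric.closedBall (0 : E) Δ) :
    ‖(∫ x, weightedChar hβ Δ x ∂μ) ξ‖ = weightedFourier β μ ξ := by
  rw [ContinuousMap.integral_apply (integrable_weightedChar hβ hΔ μ)]
  simp only [weightedChar_apply]
  rw [integral_const_mul, norm_mul, Complex.norm_real, Real.norm_of_nonneg (by positivity),
    mul_comm]
  rfl

end Kernel

/-! ### Lagrange multipliers by Hahn–Banach separation -/

section Duality

variable {d : ℕ}

local notation "E" => EuclideanSpace ℝ (Fin d)

/-- Competitors of mass `m` with finite moment, whose weighted Fourier transform is at most `M` near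
infinity. -/
structure IsCompetitor (α β M m : ℝ) (ν : Measure E) : Prop where
  finite : IsFiniteMeasure ν
  mass : ν.real univ = m
  integrable : Integrable (fun x => ‖x‖ ^ α) ν
  large : ∃ Δ', ∀ ξ, Δ' < ‖ξ‖ → weightedFourier β ν ξ ≤ M

theorem IsCompetitor.mix {α β M m : ℝ} {μ ν : Measure E} (hμ : IsCompetitor α β M m μ)
    (hν : IsCompetitor α β M m ν) {s t : ℝ≥0} (hst : s + t = 1) :
    IsCompetitor α β M m (s • μ + t • ν) := by
  have := hμ.finite
  have := hν.finite
  have hst' : (s : ℝ) + t = 1 := by exact_mod_cast hst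
  refine ⟨inferInstance, ?_, ?_, ?_⟩
  · rw [real_univ_mix, hμ.mass, hν.mass, ← add_mul, hst', one_mul]
  · exact Integrable.add_measure hμ.integrable.smul_measure_nnreal
      hν.integrable.smul_measure_nnreal
  · obtain ⟨a, ha⟩ := hμ.large
    obtain ⟨b, hb⟩ := hν.large
    refine ⟨max a b, fun ξ hξ => (weightedFourier_mix_le β μ ν s t ξ).trans ?_⟩
    have h1 := mul_le_mul_of_nonneg_left (ha ξ ((le_max_left _ _).trans_lt hξ)) s.2
    have h2 := mul_le_mul_of_nonneg_left (hb ξ ((le_max_right _ _).trans_lt hξ)) t.2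
    calc _ ≤ (s : ℝ) * M + t * M := add_le_add h1 h2
      _ = M := by rw [← add_mul, hst', one_mul]

theorem weightedFourier_map_smul {β L : ℝ} (hL : 0 < L) (μ : Measure E) (ξ : E) :
    weightedFourier β (μ.map fun x => L • x) ξ = L ^ (-β) * weightedFourier β μ (L • ξ) := by
  rw [weightedFourier, weightedFourier, measureFourier_map_smul, norm_smul,
    Real.norm_of_nonneg hL.le, Real.mul_rpow hL.le (norm_nonneg _), Real.rpow_neg hL.le]
  field_simp

theorem IsExtremizer.isCompetitor_map_smul {α β M : ℝ} (hα : 0 < α) (hβ : 0 < β) {μ : Measure E}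
    [IsFiniteMeasure μ] (h : IsExtremizer α β M μ) {L : ℝ} (hL : 1 ≤ L) :
    IsCompetitor α β M (μ.real univ) (μ.map fun x => L • x) := by
  have hL0 : 0 < L := one_pos.trans_le hL
  refine ⟨inferInstance, ?_, ?_, 0, fun ξ _ => ?_⟩
  · rw [map_measureReal_apply (by fun_prop) MeasurableSet.univ, preimage_univ]
  · rw [integrable_map_measure
      (continuous_norm.rpow_const fun _ => Or.inr hα.le).aestronglyMeasurable (by fun_prop)]
    refine (h.integrable.const_mul (L ^ α)).congr (Eventually.of_forall fun x => ?_)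
    simp only [Function.comp, norm_smul, Real.norm_of_nonneg hL0.le,
      Real.mul_rpow hL0.le (norm_nonneg _)]
  · rw [weightedFourier_map_smul hL0]
    have h1 : L ^ (-β) ≤ 1 := Real.rpow_le_one_of_one_le_of_nonpos hL (by linarith)
    calc _ ≤ 1 * M := mul_le_mul h1 (h.le_sup _) (weightedFourier_nonneg _ _ _) zero_le_one
      _ = M := one_mul M

/-- Lagrange multipliers for the moment minimisation constrained on the ball of radius `Δ`. -/
theorem IsExtremizer.exists_multiplier {α β M Δ : ℝ} (hα : 0 < α) (hβ : 0 < β) {μ : Measure E}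
    [IsFiniteMeasure μ] (h : IsExtremizer α β M μ) (hΔ0 : 0 ≤ Δ)
    (hΔ : ∀ ξ, Δ ≤ ‖ξ‖ → weightedFourier β μ ξ < M) :
    ∃ (p c : ℝ) (τ : C(Metric.closedBall (0 : E) Δ, ℂ) →L[ℝ] ℝ), 0 < p ∧
      (∀ ν : Measure E, IsCompetitor α β M (μ.real univ) ν →
        c ≤ p * (∫ x, ‖x‖ ^ α ∂ν) + ∫ x, τ (weightedChar hβ Δ x) ∂ν) ∧
      p * (∫ x, ‖x‖ ^ α ∂μ) + ∫ x, τ (weightedChar hβ Δ x) ∂μ ≤ c := by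
  set m := μ.real univ with hm
  have hM := h.sup_pos
  set I := ∫ x, ‖x‖ ^ α ∂μ with hI
  let A : Set (ℝ × C(Metric.closedBall (0 : E) Δ, ℂ)) :=
    {q | ∃ ν : Measure E, IsCompetitor α β M m ν ∧
      q = (∫ x, ‖x‖ ^ α ∂ν, ∫ x, weightedChar hβ Δ x ∂ν)}
  -- A point of `A` in this open convex set would be an admissible competitor with a moment below
  -- the minimum.
  let B : Set (ℝ × C(Metric.closedBall (0 : E) Δ, ℂ)) := Iio I ×ˢ Metric.ball 0 M
  have hA : Convex ℝ A := by
    rintro _ ⟨ν₁, h₁, rfl⟩ _ ⟨ν₂, h₂, rfl⟩ s t hs ht hst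
    have := h₁.finite
    have := h₂.finite
    lift s to ℝ≥0 using hs
    lift t to ℝ≥0 using ht
    refine ⟨s • ν₁ + t • ν₂, h₁.mix h₂ (by exact_mod_cast hst), ?_⟩
    rw [integral_mix h₁.integrable h₂.integrable,
      integral_mix (integrable_weightedChar hβ hΔ0 ν₁) (integrable_weightedChar hβ hΔ0 ν₂)]
    rfl
  have hdisj : Disjoint B A := by
    rw [Set.disjoint_left]
    rintro q ⟨hq1, hq2⟩ ⟨ν, hν, rfl⟩
    have := hν.finite
    refine absurd (h.moment_le_of_local hβ hΔ hν.mass hν.integrable hν.large fun ξ hξ => ?_)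
      (not_le.2 hq1)
    have h1 := ContinuousMap.norm_coe_le_norm (∫ x, weightedChar hβ Δ x ∂ν)
      ⟨ξ, mem_closedBall_zero_iff.2 hξ⟩
    rw [norm_integral_weightedChar_apply hβ hΔ0] at h1
    exact h1.trans (mem_ball_zero_iff.1 hq2).le
  obtain ⟨f, c, hfB, hfA⟩ := geometric_hahn_banach_open
    ((convex_Iio I).prod (convex_ball 0 M)) (isOpen_Iio.prod Metric.isOpen_ball) hA hdisj
  set p := f.comp (ContinuousLinearMap.inl ℝ ℝ _) 1 with hp
  set τ : C(Metric.closedBall (0 : E) Δ, ℂ) →L[ℝ] ℝ :=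
    f.comp (ContinuousLinearMap.inr ℝ ℝ _) with hτ
  have hf : ∀ b g, f (b, g) = p * b + τ g := by
    intro b g
    have h1 := f.comp_inl_add_comp_inr (b, g)
    have h2 := (f.comp (ContinuousLinearMap.inl ℝ ℝ _)).map_smul b 1
    rw [smul_eq_mul, mul_one, smul_eq_mul, mul_comm] at h2
    rw [← h1, h2]
  have hB : ∀ b g, b < I → ‖g‖ < M → p * b + τ g < c := by
    intro b g hb hg
    rw [← hf]
    exact hfB _ ⟨hb, mem_ball_zero_iff.2 hg⟩
  have hA' : ∀ ν : Measure E, IsCompetitor α β M m ν →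
      c ≤ p * (∫ x, ‖x‖ ^ α ∂ν) + τ (∫ x, weightedChar hβ Δ x ∂ν) := by
    intro ν hν
    rw [← hf]
    exact hfA _ ⟨ν, hν, rfl⟩
  have hτint : ∀ ν : Measure E, IsFiniteMeasure ν →
      ∫ x, τ (weightedChar hβ Δ x) ∂ν = τ (∫ x, weightedChar hβ Δ x ∂ν) := fun ν _ =>
    τ.integral_comp_comm (integrable_weightedChar hβ hΔ0 ν)
  -- The first coordinate of `B` is unbounded below, so a negative p would violate the upper bound
  -- c.
  have hp0 : 0 ≤ p := by
    by_contra hneg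
    have hneg := not_le.1 hneg
    have ht : Tendsto (fun b => p * b) atBot atTop := tendsto_id.const_mul_atBot_of_neg hneg
    obtain ⟨b, hb1, hb2⟩ := ((ht.eventually_gt_atTop c).and (eventually_lt_atBot I)).exists
    have := hB b 0 hb2 (by simpa using hM)
    rw [map_zero, add_zero] at this
    exact lt_asymm hb1 this
  -- Slater's condition: dilating μ by L multiplies the weighted transform by L^{-β} up to a change
  -- of variable, so its sup norm tends to 0. If p = 0 this contradicts the lower bound c > 0 on
  -- competitors.
  have hp1 : 0 < p := by
    refine lt_of_le_of_ne hp0 fun hpz => ?_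
    have hc : 0 < c := by
      have := hB (I - 1) 0 (by linarith) (by simpa using hM)
      rwa [map_zero, add_zero, ← hpz, zero_mul] at this
    have hlim : Tendsto (fun L : ℝ => ‖τ‖ * (L ^ (-β) * M)) atTop (𝓝 0) := by
      simpa using ((tendsto_rpow_neg_atTop hβ).mul_const M).const_mul ‖τ‖
    obtain ⟨L, hL1, hL2⟩ :=
      ((hlim.eventually (eventually_lt_nhds hc)).and (eventually_ge_atTop 1)).exists
    have hL0 : 0 < L := one_pos.trans_le hL2
    have hcomp := h.isCompetitor_map_smul hα hβ hL2
    have h1 := hA' _ hcomp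
    rw [← hpz, zero_mul, zero_add] at h1
    have h2 : ‖∫ x, weightedChar hβ Δ x ∂(μ.map fun x => L • x)‖ ≤ L ^ (-β) * M := by
      refine (ContinuousMap.norm_le _ (by positivity)).2 fun ξ => ?_
      rw [norm_integral_weightedChar_apply hβ hΔ0, weightedFourier_map_smul hL0]
      exact mul_le_mul_of_nonneg_left (h.le_sup _) (by positivity)
    have h3 := (le_abs_self _).trans ((τ.le_opNorm
      (∫ x, weightedChar hβ Δ x ∂(μ.map fun x => L • x))).trans (mul_le_mul_of_nonneg_left h2 (norm_nonneg τ)))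
    linarith
  refine ⟨p, c, τ, hp1, fun ν hν => ?_, ?_⟩
  · rw [hτint ν hν.finite]
    exact hA' ν hν
  · rw [hτint μ inferInstance]
    set G := ∫ x, weightedChar hβ Δ x ∂μ with hG
    have hGM : ‖G‖ ≤ M := by
      refine (ContinuousMap.norm_le _ hM.le).2 fun ξ => ?_
      rw [norm_integral_weightedChar_apply hβ hΔ0]
      exact h.le_sup _
    -- The point of μ itself lies only in the closure of `B`; it is approached from inside.
    have ht : Tendsto (fun s : ℝ => p * (I - s) + τ ((1 - s) • G)) (𝓝[>] 0)
        (𝓝 (p * (I - 0) + τ ((1 - 0 : ℝ) • G))) := by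
      refine Tendsto.mono_left (Continuous.tendsto ?_ 0) nhdsWithin_le_nhds
      fun_prop
    rw [sub_zero, sub_zero, one_smul] at ht
    refine le_of_tendsto ht ?_
    filter_upwards [Ioo_mem_nhdsGT (zero_lt_one (α := ℝ))] with s hs
    refine (hB _ _ (by linarith [hs.1]) ?_).le
    rw [norm_smul, Real.norm_of_nonneg (by linarith [hs.2])]
    nlinarith [hs.1, hs.2, norm_nonneg G]

end Duality

/-! ### The dual certificate, and finiteness of the set of radii -/

section Pointwise

variable {d : ℕ}

local notation "E" => EuclideanSpace ℝ (Fin d)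

theorem add_rpow_le_two_rpow_mul {a b α : ℝ} (ha : 0 ≤ a) (hb : 0 ≤ b) (hα : 0 ≤ α) :
    (a + b) ^ α ≤ 2 ^ α * (a ^ α + b ^ α) := by
  have h1 : a + b ≤ 2 * max a b := by
    linarith [le_max_left a b, le_max_right a b]
  have h2 : (max a b) ^ α ≤ a ^ α + b ^ α := by
    have := Real.rpow_nonneg ha α
    have := Real.rpow_nonneg hb α
    rcases max_cases a b with ⟨h, _⟩ | ⟨h, _⟩ <;> rw [h] <;> linarith
  calc (a + b) ^ α ≤ (2 * max a b) ^ α := by gcongr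
    _ = 2 ^ α * (max a b) ^ α := Real.mul_rpow zero_le_two (ha.trans (le_max_left _ _))
    _ ≤ _ := by gcongr

theorem norm_add_smul_rpow_le {α ε : ℝ} (hα : 0 ≤ α) (hε0 : 0 ≤ ε) (hε : ε ≤ 1) (x v : E) :
    ‖x + ε • v‖ ^ α ≤ 2 ^ α * (‖x‖ ^ α + ‖v‖ ^ α) := by
  refine le_trans ?_ (add_rpow_le_two_rpow_mul (norm_nonneg x) (norm_nonneg v) hα)
  have : ‖x + ε • v‖ ≤ ‖x‖ + ‖v‖ := by
    refine (norm_add_le _ _).trans ?_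
    rw [norm_smul, Real.norm_of_nonneg hε0]
    nlinarith [norm_nonneg v]
  gcongr

theorem integrable_gauss_bound [NeZero d] {α : ℝ} (hα : 0 < α) (x : E) :
    Integrable (fun v : E => 2 ^ α * (‖x‖ ^ α + ‖v‖ ^ α)) (gaussMeasure d) := by
  refine ((integrable_const _).add (integrable_norm_rpow_gaussMeasure ?_)).const_mul _
  have := Nat.cast_nonneg (α := ℝ) d
  linarith

/-- Point masses are not competitors, as their transforms do not decay. Narrow Gaussians replace
them: a competitor is constrained only near infinity, so its weighted transform may exceed M
elsewhere. -/
theorem isCompetitor_gauss [NeZero d] {α β M ε : ℝ} (hα : 0 < α) (hM : 0 < M)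
    (m : ℝ≥0) (hε0 : 0 < ε) (hε : ε ≤ 1) (x : E) :
    IsCompetitor α β M m (m • (gaussMeasure d).map fun v => x + ε • v) := by
  have : IsProbabilityMeasure ((gaussMeasure d).map fun v => x + ε • v) :=
    Measure.isProbabilityMeasure_map (by fun_prop)
  have hc : Continuous fun y : E => ‖y‖ ^ α := continuous_norm.rpow_const fun _ => Or.inr hα.le
  refine ⟨inferInstance, ?_, ?_, ?_⟩
  · rw [measureReal_nnreal_smul_apply, probReal_univ, mul_one]
  · refine Integrable.smul_measure_nnreal ?_
    rw [integrable_map_measure hc.aestronglyMeasurable (by fun_prop)]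
    refine (integrable_gauss_bound hα x).mono' ?_ (Eventually.of_forall fun v => ?_)
    · exact (hc.comp (by fun_prop)).aestronglyMeasurable
    · rw [Real.norm_of_nonneg (by simp only [Function.comp]; positivity)]
      exact norm_add_smul_rpow_le hα.le hε0.le hε x v
  · have h := ((tendsto_rpow_mul_exp_neg_sq β (b := Real.pi * ε ^ 2)
      (by have := Real.pi_pos; positivity)).const_mul (m : ℝ))
    rw [mul_zero] at h
    obtain ⟨R, hR⟩ := eventually_atTop.1 (h.eventually (eventually_le_nhds hM))
    refine ⟨R, fun ξ hξ => ?_⟩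
    refine le_of_eq_of_le ?_ (hR _ hξ.le)
    rw [weightedFourier, measureFourier_smul, norm_mul, norm_measureFourier_gauss_affine]
    simp only [Complex.norm_real, NNReal.norm_eq, mul_assoc]
    congr 3
    ring

/-- The dual certificate: `|x|^α` plus a function of the form `τ(|ξ|^β exp(-2πi⟨x, ξ⟩))` attains its
minimum on the support of the extremizer. -/
theorem IsExtremizer.exists_certificate [NeZero d] {α β M Δ : ℝ} (hα : 0 < α) (hβ : 0 < β)
    {μ : Measure E} [IsFiniteMeasure μ] (h : IsExtremizer α β M μ) (hΔ0 : 0 ≤ Δ)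
    (hΔ : ∀ ξ, Δ ≤ ‖ξ‖ → weightedFourier β μ ξ < M) :
    ∃ (p c : ℝ) (τ : C(Metric.closedBall (0 : E) Δ, ℂ) →L[ℝ] ℝ), 0 < p ∧
      ∀ x ∈ μ.support, p * ‖x‖ ^ α + τ (weightedChar hβ Δ x) = c := by
  obtain ⟨p, c, τ, hp, h1, h2⟩ := h.exists_multiplier hα hβ hΔ0 hΔ
  have hm := h.mass_pos
  set m := μ.real univ with hmdef
  set φ : E → ℝ := fun x => p * ‖x‖ ^ α + τ (weightedChar hβ Δ x) with hφ
  have hnc : Continuous fun y : E => ‖y‖ ^ α := continuous_norm.rpow_const fun _ => Or.inr hα.le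
  have hφc : Continuous φ :=
    (hnc.const_mul p).add (τ.continuous.comp (continuous_weightedChar hβ Δ))
  have hτb : ∀ x : E, |τ (weightedChar hβ Δ x)| ≤ ‖τ‖ * Δ ^ β := fun x =>
    (τ.le_opNorm _).trans (mul_le_mul_of_nonneg_left (norm_weightedChar_le hβ hΔ0 x)
      (norm_nonneg _))
  have hτi : ∀ ν : Measure E, IsFiniteMeasure ν →
      Integrable (fun x => τ (weightedChar hβ Δ x)) ν := fun ν _ =>
    τ.integrable_comp (integrable_weightedChar hβ hΔ0 ν)
  have hsplit : ∀ ν : Measure E, IsFiniteMeasure ν → Integrable (fun x => ‖x‖ ^ α) ν →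
      ∫ x, φ x ∂ν = p * (∫ x, ‖x‖ ^ α ∂ν) + ∫ x, τ (weightedChar hβ Δ x) ∂ν := by
    intro ν hν hi
    rw [hφ, integral_add (hi.const_mul p) (hτi ν hν), integral_const_mul]
  -- The multiplier inequality for a Gaussian of mass m centred at x, as its width tends to 0.
  have hge : ∀ x, c ≤ m * φ x := by
    intro x
    have hlim : Tendsto (fun ε : ℝ => ∫ v, φ (x + ε • v) ∂(gaussMeasure d)) (𝓝[>] 0)
        (𝓝 (∫ _, φ x ∂(gaussMeasure d))) := by
      refine tendsto_integral_filter_of_dominated_convergence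
        (fun v => p * (2 ^ α * (‖x‖ ^ α + ‖v‖ ^ α)) + ‖τ‖ * Δ ^ β) ?_ ?_ ?_ ?_
      · exact Eventually.of_forall fun ε => (hφc.comp (by fun_prop)).aestronglyMeasurable
      · filter_upwards [Ioo_mem_nhdsGT (zero_lt_one (α := ℝ))] with ε hε
        refine Eventually.of_forall fun v => ?_
        rw [Real.norm_eq_abs]
        refine (abs_add_le _ _).trans (add_le_add ?_ (hτb _))
        rw [abs_of_nonneg (by positivity)]
        exact mul_le_mul_of_nonneg_left
          (norm_add_smul_rpow_le hα.le hε.1.le hε.2.le x v) hp.le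
      · exact ((integrable_gauss_bound hα x).const_mul p).add (integrable_const _)
      · refine Eventually.of_forall fun v => Tendsto.mono_left ?_ nhdsWithin_le_nhds
        have : Continuous fun ε : ℝ => φ (x + ε • v) := hφc.comp (by fun_prop)
        simpa using this.tendsto 0
    rw [integral_const, probReal_univ, one_smul] at hlim
    refine ge_of_tendsto (hlim.const_mul m) ?_
    filter_upwards [Ioo_mem_nhdsGT (zero_lt_one (α := ℝ))] with ε hε
    obtain ⟨m', hm'⟩ : ∃ m' : ℝ≥0, (m' : ℝ) = m := ⟨m.toNNReal, Real.coe_toNNReal m hm.le⟩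
    have hcomp := isCompetitor_gauss (β := β) hα h.sup_pos m' hε.1 hε.2.le x
    rw [hm'] at hcomp
    have h3 := h1 _ hcomp
    rw [← hsplit _ hcomp.finite hcomp.integrable, integral_smul_nnreal_measure,
      integral_map (by fun_prop) hφc.aestronglyMeasurable, NNReal.smul_def, hm'] at h3
    exact h3
  have hφi : Integrable φ μ := (h.integrable.const_mul p).add (hτi μ inferInstance)
  -- Complementary slackness: the function is non-negative and its μ-integral m ∫ φ dμ - cm is at
  -- most 0.
  have hzero : ∀ᵐ x ∂μ, m * φ x - c = 0 := by
    have hint : Integrable (fun x => m * φ x - c) μ :=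
      (hφi.const_mul m).sub (integrable_const c)
    refine (integral_eq_zero_iff_of_nonneg (fun x => sub_nonneg.2 (hge x)) hint).1 ?_
    refine le_antisymm ?_ (integral_nonneg fun x => sub_nonneg.2 (hge x))
    rw [integral_sub (hφi.const_mul m) (integrable_const c), integral_const_mul, integral_const,
      hsplit μ inferInstance h.integrable, smul_eq_mul, ← hmdef]
    nlinarith
  have hsupp : μ.support ⊆ {x | m * φ x - c = 0} :=
    Measure.support_subset_of_isClosed (isClosed_eq (by fun_prop) continuous_const) hzero
  refine ⟨p, c / m, τ, hp, fun x hx => ?_⟩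
  have h4 : m * φ x - c = 0 := hsupp hx
  change φ x = c / m
  rw [eq_div_iff hm.ne']
  linarith

/-- In the Banach algebra C(ball, ℂ) the vector at r·e is a fixed element times exp(r·u). Here u is
a bounded function because the ball is compact, and τ is continuous and linear. -/
theorem analyticOnNhd_weightedChar {β Δ : ℝ} (hβ : 0 < β)
    (τ : C(Metric.closedBall (0 : E) Δ, ℂ) →L[ℝ] ℝ) (e : E) :
    AnalyticOnNhd ℝ (fun r : ℝ => τ (weightedChar hβ Δ (r • e))) univ := by
  let u : C(Metric.closedBall (0 : E) Δ, ℂ) :=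
    ⟨fun ξ => -2 * Real.pi * Complex.I * ((inner ℝ e (ξ : E) : ℝ) : ℂ), by fun_prop⟩
  have hexp : ∀ r : ℝ, weightedChar hβ Δ (r • e) = weightedChar hβ Δ 0 * NormedSpace.exp (r • u) := by
    intro r
    ext ξ
    have h1 : (NormedSpace.exp (r • u)) ξ = Complex.exp ((r • u) ξ) := by
      have := NormedSpace.map_exp (ContinuousMap.evalAlgHom ℝ ℂ ξ)
        (continuous_eval_const ξ) (r • u)
      rw [Complex.exp_eq_exp_ℂ]
      exact this
    rw [ContinuousMap.mul_apply, h1, weightedChar_apply, weightedChar_apply]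
    simp only [inner_zero_left, Complex.ofReal_zero, mul_zero, Complex.exp_zero, mul_one,
      ContinuousMap.smul_apply, inner_smul_left]
    congr 2
    change _ = r • (-2 * Real.pi * Complex.I * ((inner ℝ e (ξ : E) : ℝ) : ℂ))
    rw [Complex.real_smul]
    simp
    ring
  simp_rw [hexp]
  intro r _
  have h2 : AnalyticAt ℝ (fun r : ℝ => NormedSpace.exp (r • u)) r :=
    (NormedSpace.exp_analytic (𝕂 := ℝ) (r • u)).comp
      (f := fun r : ℝ => r • u)
      (((ContinuousLinearMap.id ℝ ℝ).smulRight u).analyticAt r)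
  exact ((τ.comp (ContinuousLinearMap.mul ℝ _ (weightedChar hβ Δ 0))).analyticAt _).comp h2

theorem analyticAt_rpow_const_of_pos (α : ℝ) {r : ℝ} (hr : 0 < r) :
    AnalyticAt ℝ (fun r : ℝ => r ^ α) r :=
  (Real.contDiffAt_rpow_const_of_ne (n := ⊤) hr.ne').analyticAt

/-- If `g` is bounded and real-analytic, then `p r^α + g r` has finitely many zeros on `[0, ∞)`. -/
theorem finite_zeros_rpow_add {α p C : ℝ} (hα : 0 < α) (hp : 0 < p) {g : ℝ → ℝ}
    (hg : AnalyticOnNhd ℝ g univ) (hb : ∀ r, |g r| ≤ C) :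
    {r : ℝ | 0 ≤ r ∧ p * r ^ α + g r = 0}.Finite := by
  have hgrow : ∀ᶠ r in atTop, 0 < p * r ^ α + g r := by
    have := ((tendsto_rpow_atTop hα).const_mul_atTop hp).eventually_gt_atTop C
    filter_upwards [this] with r hr
    linarith [neg_abs_le (g r), hb r]
  obtain ⟨R, hR⟩ := eventually_atTop.1 hgrow
  have hsub : {r : ℝ | 0 ≤ r ∧ p * r ^ α + g r = 0} ⊆ Icc 0 R := fun r hr =>
    ⟨hr.1, (not_le.1 fun h => (hR r h).ne' hr.2).le⟩
  by_contra hinf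
  obtain ⟨a, ha, hacc⟩ := (show Set.Infinite _ from hinf).exists_accPt_of_subset_isCompact
    isCompact_Icc hsub
  rw [accPt_iff_frequently_nhdsNE] at hacc
  -- Accumulation of zeros at a positive point would make the function vanish on all of (0, ∞),
  -- against its growth.
  have hnotall : ∀ G : ℝ → ℝ, AnalyticOnNhd ℝ G (Ioi 0) →
      (∀ r, 0 < r → G r = p * r ^ α + g r) → ∀ b, 0 < b → (∃ᶠ r in 𝓝[≠] b, G r = 0) → False := by
    intro G hG hGe b hb0 hfr
    have := hG.eqOn_zero_of_preconnected_of_frequently_eq_zero isPreconnected_Ioi hb0 hfr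
    have h0 : 0 < max R 1 := by positivity
    have h1 := hR (max R 1) (le_max_left _ _)
    rw [← hGe _ h0, this h0] at h1
    exact lt_irrefl _ h1
  rcases ha.1.eq_or_lt with h0 | h0
  · subst h0
    have hacc' : ∃ᶠ r in 𝓝[>] (0 : ℝ), p * r ^ α + g r = 0 := by
      rw [frequently_nhdsWithin_iff] at hacc ⊢
      exact hacc.mono fun r hr => ⟨hr.1.2, lt_of_le_of_ne hr.1.1 (Ne.symm hr.2)⟩
    -- At 0 the power r^α need not be analytic. Instead g is factored there as r^n u(r) with u(0) ≠
    -- 0, and the equation is divided by r^n.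
    have hgn : ¬ ∀ᶠ r in 𝓝 (0 : ℝ), g r = 0 := by
      intro hz
      have hz' : ∀ᶠ r in 𝓝[>] (0 : ℝ), g r = 0 := hz.filter_mono nhdsWithin_le_nhds
      obtain ⟨r, hr, hgr, hr0⟩ := (hacc'.and_eventually (hz'.and self_mem_nhdsWithin)).exists
      have hr0 : 0 < r := hr0
      rw [hgr, add_zero] at hr
      exact (by positivity : p * r ^ α ≠ 0) hr
    obtain ⟨n, u, hu, hu0, hgu⟩ :=
      (hg 0 (mem_univ 0)).exists_eventuallyEq_pow_smul_nonzero_iff.2 hgn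
    simp only [sub_zero, smul_eq_mul] at hgu
    have hfr : ∃ᶠ r in 𝓝[>] (0 : ℝ), p * r ^ (α - n) + u r = 0 := by
      refine (hacc'.and_eventually ((hgu.filter_mono nhdsWithin_le_nhds).and
        self_mem_nhdsWithin)).mono ?_
      rintro r ⟨h1, h2, h3⟩
      have h3 : 0 < r := h3
      rw [h2] at h1
      have h4 : r ^ α = r ^ (α - n) * r ^ n := by
        rw [← Real.rpow_natCast, ← Real.rpow_add h3, sub_add_cancel]
      rw [h4] at h1
      have h5 : (p * r ^ (α - n) + u r) * r ^ n = 0 := by linear_combination h1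
      exact (mul_eq_zero.1 h5).resolve_right (by positivity)
    have hut : Tendsto u (𝓝[>] 0) (𝓝 (u 0)) :=
      hu.continuousAt.tendsto.mono_left nhdsWithin_le_nhds
    -- The quotient p r^{α-n} + u(r) tends to ∞ if α < n and to u(0) ≠ 0 if α > n. If α = n, the
    -- original function is analytic across 0 and the identity theorem applies.
    rcases lt_trichotomy α n with hlt | heq | hgt
    · have hat : Tendsto (fun r : ℝ => p * r ^ (α - n)) (𝓝[>] 0) atTop :=
        (tendsto_rpow_neg_nhdsGT_zero (by linarith)).const_mul_atTop hp
      exact hfr ((hat.atTop_add hut).eventually_ne_atTop 0)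
    · refine hnotall (fun r => p * r ^ n + g r)
        (fun r _ => (analyticAt_const.mul (analyticAt_id.pow n)).add (hg r (mem_univ r)))
        (fun r hr => by rw [heq, Real.rpow_natCast]) 1 one_pos ?_
      have hall := AnalyticOnNhd.eqOn_zero_of_preconnected_of_frequently_eq_zero
        (f := fun r => p * r ^ n + g r) (U := univ) (z₀ := 0)
        (fun r _ => (analyticAt_const.mul (analyticAt_id.pow n)).add (hg r (mem_univ r)))
        isPreconnected_univ (mem_univ _) ?_
      · exact (Eventually.of_forall fun r => hall (mem_univ r)).frequently
      · rw [heq] at hacc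
        simp only [Real.rpow_natCast] at hacc
        exact hacc.mono fun r hr => hr.2
    · have h00 : Tendsto (fun r : ℝ => p * r ^ (α - n) + u r) (𝓝[>] 0) (𝓝 (p * 0 + u 0)) := by
        refine Tendsto.add (Tendsto.const_mul p ?_) hut
        have := (Real.continuousAt_rpow_const 0 (α - n) (Or.inr (by linarith))).tendsto
        rw [Real.zero_rpow (by linarith)] at this
        exact this.mono_left nhdsWithin_le_nhds
      rw [mul_zero, zero_add] at h00
      exact hfr (h00.eventually_ne hu0)
  · refine hnotall (fun r => p * r ^ α + g r) (fun r hr => ?_) (fun r _ => rfl) a h0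
      (hacc.mono fun r hr => hr.2)
    exact (analyticAt_const.mul (analyticAt_rpow_const_of_pos α hr)).add (hg r (mem_univ r))

theorem IsRadialMeasure.map_mem_support {μ : Measure E} (hμ : IsRadialMeasure μ) {x y : E}
    (hx : x ∈ μ.support) (h : ‖x‖ = ‖y‖) : y ∈ μ.support := by
  obtain ⟨R, rfl⟩ := exists_isometry_map_eq h
  rw [Measure.mem_support_iff_forall] at hx ⊢
  intro U hU
  have h1 := hx (R ⁻¹' U) (R.continuous.continuousAt.preimage_mem_nhds hU)
  have h2 : μ.map R U = μ (R ⁻¹' U) := R.toHomeomorph.toMeasurableEquiv.map_apply U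
  rwa [← h2, hμ R] at h1

/-- If the supremum is not attained near infinity, the extremizer lives on finitely many spheres. -/
theorem IsExtremizer.finite_norm_support [NeZero d] {α β M Δ : ℝ} (hα : 0 < α) (hβ : 0 < β)
    {μ : Measure E} [IsFiniteMeasure μ] (hrad : IsRadialMeasure μ) (h : IsExtremizer α β M μ)
    (hΔ0 : 0 ≤ Δ) (hΔ : ∀ ξ, Δ ≤ ‖ξ‖ → weightedFourier β μ ξ < M) :
    (norm '' μ.support).Finite := by
  obtain ⟨p, c, τ, hp, hτ⟩ := h.exists_certificate hα hβ hΔ0 hΔ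
  obtain ⟨e, he⟩ := exists_unit_vector (d := d)
  refine (finite_zeros_rpow_add (p := p) (C := ‖τ‖ * Δ ^ β + |c|) hα hp
    (g := fun r => τ (weightedChar hβ Δ (r • e)) - c)
    ((analyticOnNhd_weightedChar hβ τ e).sub analyticOnNhd_const) fun r => ?_).subset ?_
  · refine (abs_sub _ _).trans (add_le_add ((τ.le_opNorm _).trans ?_) le_rfl)
    exact mul_le_mul_of_nonneg_left (norm_weightedChar_le hβ hΔ0 _) (norm_nonneg _)
  · rintro _ ⟨x, hx, rfl⟩
    have hn : ‖‖x‖ • e‖ = ‖x‖ := by rw [norm_smul, he, mul_one, norm_norm]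
    -- By radiality the certificate may be evaluated on the single ray through e.
    have := hτ _ (hrad.map_mem_support hx hn.symm)
    rw [hn] at this
    exact ⟨norm_nonneg x, by linarith⟩

end Pointwise

/-! ### Energy lower bound for measures on finitely many spheres -/

section Energy

variable {d : ℕ}

local notation "E" => EuclideanSpace ℝ (Fin d)

/-- The spherical shells of half-width `ε` around the radii in `S`. -/
def shells (d : ℕ) (S : Set ℝ) (ε : ℝ) : Set (EuclideanSpace ℝ (Fin d)) :=
  {z | ∃ r ∈ S, |‖z‖ - r| < ε}

theorem volume_real_ball [NeZero d] {r : ℝ} (hr : 0 ≤ r) :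
    (volume : Measure E).real (Metric.ball 0 r) =
      r ^ d * (volume : Measure E).real (Metric.ball 0 1) := by
  have : Nontrivial E := by
    obtain ⟨e, he⟩ := exists_unit_vector (d := d)
    exact ⟨e, 0, fun h => by simp [h] at he⟩
  rw [measureReal_def, Measure.addHaar_ball _ _ hr, ENNReal.toReal_mul,
    ENNReal.toReal_ofReal (by positivity), finrank_euclideanSpace_fin]
  rfl

theorem volume_shell_le [NeZero d] {r ε : ℝ} (hr : 0 ≤ r) (hε0 : 0 < ε) (hε : ε ≤ 1) :
    (volume : Measure E).real {z | |‖z‖ - r| < ε} ≤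
      (volume : Measure E).real (Metric.ball 0 1) * (2 * d * (r + 1) ^ (d - 1)) * ε := by
  set ω := (volume : Measure E).real (Metric.ball 0 1) with hω
  have hω0 : 0 ≤ ω := measureReal_nonneg
  -- Truncation covers the case r < ε, where the inner ball is empty.
  set s := max (r - ε) 0 with hs
  have hs0 : 0 ≤ s := le_max_right _ _
  have hsr : s ≤ r + ε := max_le (by linarith) (by linarith)
  have hsub : {z : E | |‖z‖ - r| < ε} ⊆ Metric.ball 0 (r + ε) \ Metric.ball 0 s := by
    intro z hz
    have hz' := abs_lt.1 (show |‖z‖ - r| < ε from hz)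
    refine ⟨mem_ball_zero_iff.2 (by linarith), fun hzs => ?_⟩
    have h1 := mem_ball_zero_iff.1 hzs
    rcases max_cases (r - ε) 0 with ⟨h, _⟩ | ⟨h, _⟩ <;> rw [hs, h] at h1
    · linarith
    · linarith [norm_nonneg z]
  have hfin : (volume : Measure E) (Metric.ball 0 (r + ε) \ Metric.ball 0 s) ≠ ∞ :=
    ((measure_mono sdiff_subset).trans_lt measure_ball_lt_top).ne
  refine (measureReal_mono hsub hfin).trans ?_
  rw [measureReal_sdiff (Metric.ball_subset_ball hsr) measurableSet_ball measure_ball_lt_top.ne,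
    volume_real_ball (by linarith), volume_real_ball hs0, ← sub_mul, ← hω]
  have h2 : (r + ε) ^ d - s ^ d ≤ (2 * ε) * d * (r + 1) ^ (d - 1) := by
    refine (le_abs_self _).trans ((abs_pow_sub_pow_le _ _ _).trans ?_)
    have h3 : |r + ε - s| ≤ 2 * ε := by
      rw [abs_of_nonneg (by linarith)]
      linarith [le_max_left (r - ε) 0]
    have h4 : max |r + ε| |s| ≤ r + 1 := by
      rw [abs_of_nonneg (by linarith), abs_of_nonneg hs0]
      exact max_le (by linarith) (by linarith)
    gcongr
  nlinarith [mul_le_mul_of_nonneg_right h2 hω0]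

theorem volume_shells_le [NeZero d] {S : Set ℝ} (hS : S.Finite) (hS0 : ∀ r ∈ S, 0 ≤ r) :
    ∃ K, 0 < K ∧ ∀ ε, 0 < ε → ε ≤ 1 →
      (volume : Measure E) (shells d S ε) ≤ ENNReal.ofReal (K * ε) := by
  set c : ℝ → ℝ := fun r =>
    (volume : Measure E).real (Metric.ball 0 1) * (2 * d * (r + 1) ^ (d - 1)) with hc
  have hc0 : ∀ r ∈ hS.toFinset, 0 ≤ c r := by
    intro r hr
    have := hS0 r (hS.mem_toFinset.1 hr)
    positivity
  refine ⟨∑ r ∈ hS.toFinset, c r + 1, by linarith [Finset.sum_nonneg hc0], fun ε hε0 hε => ?_⟩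
  have hcover : shells d S ε ⊆ ⋃ r ∈ hS.toFinset, {z : E | |‖z‖ - r| < ε} := by
    rintro z ⟨r, hr, hz⟩
    exact mem_biUnion (hS.mem_toFinset.2 hr) hz
  have hfin : ∀ r, (volume : Measure E) {z : E | |‖z‖ - r| < ε} ≠ ∞ := by
    intro r
    refine ((measure_mono (t := Metric.ball (0 : E) (r + ε)) fun z hz => ?_).trans_lt
      measure_ball_lt_top).ne
    have hz' := abs_lt.1 (show |‖z‖ - r| < ε from hz)
    exact mem_ball_zero_iff.2 (by linarith)
  calc (volume : Measure E) (shells d S ε)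
      ≤ ∑ r ∈ hS.toFinset, (volume : Measure E) {z : E | |‖z‖ - r| < ε} :=
        (measure_mono hcover).trans (measure_biUnion_finset_le _ _)
    _ ≤ ∑ r ∈ hS.toFinset, ENNReal.ofReal (c r * ε) := by
        refine Finset.sum_le_sum fun r hr => ?_
        rw [← ofReal_measureReal (hfin r)]
        exact ENNReal.ofReal_le_ofReal
          (volume_shell_le (hS0 r (hS.mem_toFinset.1 hr)) hε0 hε)
    _ = ENNReal.ofReal (∑ r ∈ hS.toFinset, c r * ε) :=
        (ENNReal.ofReal_sum_of_nonneg fun r hr => mul_nonneg (hc0 r hr) hε0.le).symm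
    _ ≤ _ := by
        refine ENNReal.ofReal_le_ofReal ?_
        rw [← Finset.sum_mul]
        nlinarith

theorem lintegral_measure_ball (μ : Measure E) [IsFiniteMeasure μ] (ε : ℝ) :
    ∫⁻ z, μ (Metric.ball z ε) = μ univ * volume (Metric.ball (0 : E) ε) := by
  have hS : MeasurableSet {q : E × E | dist q.2 q.1 < ε} :=
    (isOpen_lt (by fun_prop) continuous_const).measurableSet
  have h1 := Measure.prod_apply (μ := (volume : Measure E)) (ν := μ) hS
  rw [Measure.prod_apply_symm hS] at h1
  refine Eq.trans h1.symm ?_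
  have : ∀ x : E, (fun z : E => (z, x)) ⁻¹' {q : E × E | dist q.2 q.1 < ε} = Metric.ball x ε := by
    intro x
    ext z
    simp [dist_comm]
  simp_rw [this, Measure.addHaar_ball_center volume _ ε]
  rw [lintegral_const, mul_comm]

/-- Tonelli: a pair of points has a common ε-neighbour z only if its distance is below 2ε, and then
z ranges within one ε-ball. -/
theorem lintegral_measure_ball_sq_le (μ : Measure E) [IsFiniteMeasure μ] (ε : ℝ) :
    ∫⁻ z, μ (Metric.ball z ε) * μ (Metric.ball z ε) ≤
      (μ.prod μ) {p | ‖p.1 - p.2‖ < 2 * ε} * volume (Metric.ball (0 : E) ε) := by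
  have hS : MeasurableSet {q : E × E × E | dist q.2.1 q.1 < ε ∧ dist q.2.2 q.1 < ε} :=
    ((isOpen_lt (f := fun q : E × E × E => dist q.2.1 q.1) (by fun_prop) continuous_const).inter
      (isOpen_lt (f := fun q : E × E × E => dist q.2.2 q.1) (by fun_prop)
        continuous_const)).measurableSet
  have h1 := Measure.prod_apply (μ := (volume : Measure E)) (ν := μ.prod μ) hS
  rw [Measure.prod_apply_symm hS] at h1
  have h2 : ∀ z : E, μ (Metric.ball z ε) * μ (Metric.ball z ε) = (μ.prod μ)
      (Prod.mk z ⁻¹' {q : E × E × E | dist q.2.1 q.1 < ε ∧ dist q.2.2 q.1 < ε}) := by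
    intro z
    rw [← Measure.prod_prod]
    rfl
  simp_rw [h2]
  rw [← h1]
  have hQ : MeasurableSet {p : E × E | ‖p.1 - p.2‖ < 2 * ε} :=
    (isOpen_lt (by fun_prop) continuous_const).measurableSet
  rw [mul_comm, ← lintegral_indicator_const hQ]
  refine lintegral_mono fun p => ?_
  by_cases hp : p ∈ {p : E × E | ‖p.1 - p.2‖ < 2 * ε}
  · rw [indicator_of_mem hp, ← Measure.addHaar_ball_center volume p.1 ε]
    refine measure_mono fun z hz => ?_
    simpa [dist_comm] using hz.1
  · rw [indicator_of_notMem hp]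
    refine (measure_mono_null (t := ∅) (fun z hz => ?_) measure_empty).le
    apply hp
    have h3 : dist p.1 p.2 ≤ dist p.1 z + dist p.2 z := dist_triangle_right _ _ _
    have h4 : dist p.1 z < ε := hz.1
    have h5 : dist p.2 z < ε := hz.2
    rw [mem_ofPred_eq, ← dist_eq_norm]
    linarith

theorem measure_ball_eq_zero_of_notMem_shells (μ : Measure E) {ε : ℝ} {z : E}
    (hz : z ∉ shells d (norm '' μ.support) ε) : μ (Metric.ball z ε) = 0 := by
  refine measure_mono_null (t := μ.supportᶜ) (fun x hx => ?_) Measure.measure_compl_support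
  intro hxs
  refine hz ⟨‖x‖, ⟨x, hxs, rfl⟩, (abs_norm_sub_norm_le z x).trans_lt ?_⟩
  rw [← dist_eq_norm, dist_comm]
  exact hx

/-- A measure on finitely many spheres has many pairs of close points. -/
theorem exists_le_measure_close_pairs [NeZero d] (μ : Measure E) [IsFiniteMeasure μ]
    (hm : 0 < μ.real univ) (hS : (norm '' μ.support).Finite) :
    ∃ c, 0 < c ∧ ∀ ε, 0 < ε → ε ≤ 1 →
      c * ε ^ (d - 1) ≤ (μ.prod μ).real {p | ‖p.1 - p.2‖ < 2 * ε} := by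
  obtain ⟨K, hK, hvol⟩ := volume_shells_le (d := d) hS (by rintro _ ⟨x, _, rfl⟩; exact norm_nonneg x)
  set m := μ.real univ with hmdef
  set ω := (volume : Measure E).real (Metric.ball 0 1) with hω
  have hω0 : 0 < ω := by
    rw [hω, measureReal_def]
    exact ENNReal.toReal_pos (Metric.measure_ball_pos _ _ one_pos).ne' measure_ball_lt_top.ne
  refine ⟨m ^ 2 * ω / K, by positivity, fun ε hε0 hε => ?_⟩
  set P := (μ.prod μ).real {p | ‖p.1 - p.2‖ < 2 * ε} with hP
  set A := shells d (norm '' μ.support) ε with hA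
  -- This is (mωε^d)/(Kε), the integral of μ(B(z,ε)) divided by the bound on the volume of the
  -- shells. With it, 2ta ≤ a² + t² integrates to the Cauchy–Schwarz bound.
  set t : ℝ := m * ω / K * ε ^ (d - 1) with ht
  have ht0 : 0 ≤ t := by positivity
  have hAo : IsOpen A := by
    have : A = ⋃ r ∈ norm '' μ.support, {z : E | |‖z‖ - r| < ε} := by
      ext z
      simp [hA, shells]
    rw [this]
    exact isOpen_biUnion fun r _ => isOpen_lt (by fun_prop) continuous_const
  have hb : (volume : Measure E) (Metric.ball 0 ε) = ENNReal.ofReal (ε ^ d * ω) := by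
    rw [← ofReal_measureReal measure_ball_lt_top.ne, volume_real_ball hε0.le]
  have hkey : ENNReal.ofReal (2 * t) * (μ univ * volume (Metric.ball (0 : E) ε)) ≤
      (μ.prod μ) {p | ‖p.1 - p.2‖ < 2 * ε} * volume (Metric.ball (0 : E) ε) +
        ENNReal.ofReal t * ENNReal.ofReal t * volume A := by
    rw [← lintegral_measure_ball, ← lintegral_const_mul' _ _ (by finiteness)]
    calc ∫⁻ z, ENNReal.ofReal (2 * t) * μ (Metric.ball z ε)
        ≤ ∫⁻ z, (μ (Metric.ball z ε) * μ (Metric.ball z ε) +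
            A.indicator (fun _ => ENNReal.ofReal t * ENNReal.ofReal t) z) := by
          refine lintegral_mono fun z => ?_
          by_cases hz : z ∈ A
          · rw [indicator_of_mem hz]
            have h := two_mul_le_add_sq (μ.real (Metric.ball z ε)) t
            rw [← ofReal_measureReal (μ := μ) (s := Metric.ball z ε),
              ← ENNReal.ofReal_mul measureReal_nonneg, ← ENNReal.ofReal_mul ht0,
              ← ENNReal.ofReal_add (by positivity) (by positivity),
              ← ENNReal.ofReal_mul (by positivity)]
            refine ENNReal.ofReal_le_ofReal ?_
            nlinarith
          · rw [measure_ball_eq_zero_of_notMem_shells μ hz]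
            simp
      _ = (∫⁻ z, μ (Metric.ball z ε) * μ (Metric.ball z ε)) +
            ENNReal.ofReal t * ENNReal.ofReal t * volume A := by
          rw [lintegral_add_right _ (measurable_const.indicator hAo.measurableSet),
            lintegral_indicator_const hAo.measurableSet]
      _ ≤ _ := add_le_add_left (lintegral_measure_ball_sq_le μ ε) _
  have hkey2 : 2 * t * (m * (ε ^ d * ω)) ≤ P * (ε ^ d * ω) + t * t * (K * ε) := by
    rw [hb, ← ofReal_measureReal (μ := μ) (s := univ),
      ← ofReal_measureReal (μ := μ.prod μ) (s := {p | ‖p.1 - p.2‖ < 2 * ε})] at hkey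
    have h1 := hkey.trans (add_le_add_right (mul_le_mul_right (hvol ε hε0 hε) _) _)
    rw [← hP, ← hmdef, ← ENNReal.ofReal_mul hm.le, ← ENNReal.ofReal_mul ht0,
      ← ENNReal.ofReal_mul measureReal_nonneg, ← ENNReal.ofReal_mul (by positivity),
      ← ENNReal.ofReal_mul (by positivity),
      ← ENNReal.ofReal_add (by positivity) (by positivity)] at h1
    exact (ENNReal.ofReal_le_ofReal_iff (by positivity)).1 h1
  have hd : ε ^ d = ε ^ (d - 1) * ε := by
    rw [← pow_succ, Nat.sub_add_cancel (Nat.one_le_iff_ne_zero.2 (NeZero.ne d))]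
  have htK : t * K = m * ω * ε ^ (d - 1) := by
    rw [ht]
    field_simp
  have h3 : t * m * (ε ^ d * ω) ≤ P * (ε ^ d * ω) := by
    have : t * t * (K * ε) = t * m * (ε ^ d * ω) := by
      rw [hd]
      linear_combination t * ε * htK
    linarith
  have h4 : t * m ≤ P := le_of_mul_le_mul_right h3 (by positivity)
  refine le_of_eq_of_le ?_ h4
  rw [ht]
  ring

theorem conv_neg_eq_map (μ : Measure E) [IsFiniteMeasure μ] :
    μ ∗ μ.map (fun x => (-1 : ℝ) • x) = (μ.prod μ).map fun p => p.1 - p.2 := by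
  rw [Measure.conv]
  nth_rewrite 1 [← Measure.map_id (μ := μ)]
  rw [Measure.map_prod_map _ _ measurable_id (by fun_prop),
    Measure.map_map (by fun_prop) (by fun_prop)]
  congr 1
  ext1 p
  simp [sub_eq_add_neg]

/-- The right side is the double integral of exp(-π|x-y|²/ε²), which is at least e^{-4π} on pairs
closer than 2ε. -/
theorem exp_mul_close_pairs_le (μ : Measure E) [IsFiniteMeasure μ] {ε : ℝ} (hε : 0 < ε) :
    Real.exp (-Real.pi * 4) * (μ.prod μ).real {p | ‖p.1 - p.2‖ < 2 * ε} ≤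
      ∫ v, ‖measureFourier μ (ε⁻¹ • v)‖ ^ 2 ∂(gaussMeasure d) := by
  have hQ : MeasurableSet {p : E × E | ‖p.1 - p.2‖ < 2 * ε} :=
    (isOpen_lt (by fun_prop) continuous_const).measurableSet
  have hc : Continuous fun z : E => Real.exp (-Real.pi * ‖ε⁻¹ • z‖ ^ 2) := by fun_prop
  rw [integral_norm_sq_measureFourier_gauss, conv_neg_eq_map,
    integral_map (by fun_prop) hc.aestronglyMeasurable, mul_comm, ← smul_eq_mul,
    ← integral_indicator_const _ hQ]
  refine integral_mono ((integrable_const _).indicator hQ) ?_ fun p => ?_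
  · refine Integrable.of_bound (C := 1) (hc.comp (by fun_prop)).aestronglyMeasurable
      (Eventually.of_forall fun p => ?_)
    rw [Real.norm_eq_abs, Real.abs_exp, Real.exp_le_one_iff]
    have := Real.pi_pos
    nlinarith [sq_nonneg ‖ε⁻¹ • (p.1 - p.2)‖]
  · by_cases hp : p ∈ {p : E × E | ‖p.1 - p.2‖ < 2 * ε}
    · rw [indicator_of_mem hp]
      refine Real.exp_le_exp.2 ?_
      have h1 : ‖ε⁻¹ • (p.1 - p.2)‖ ≤ 2 := by
        rw [norm_smul, norm_inv, Real.norm_of_nonneg hε.le, inv_mul_le_iff₀ hε, mul_comm]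
        exact (show ‖p.1 - p.2‖ < 2 * ε from hp).le
      have := Real.pi_pos
      nlinarith [norm_nonneg (ε⁻¹ • (p.1 - p.2)), mul_nonneg this.le
        (mul_nonneg (sub_nonneg.2 h1) (add_nonneg zero_le_two (norm_nonneg (ε⁻¹ • (p.1 - p.2)))))]
    · rw [indicator_of_notMem hp]
      positivity

theorem ae_ne_zero_gaussMeasure [NeZero d] : ∀ᵐ v : E ∂(gaussMeasure d), v ≠ 0 := by
  have : Nontrivial E := by
    obtain ⟨e, he⟩ := exists_unit_vector (d := d)
    exact ⟨e, 0, fun h => by simp [h] at he⟩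
  exact (withDensity_absolutelyContinuous _ _).ae_le (Measure.ae_ne volume 0)

theorem exists_exponent_between [NeZero d] {β M : ℝ} (hβ : ((d : ℝ) - 1) / 2 < β) (μ : Measure E)
    (hs : ∀ ξ, weightedFourier β μ ξ ≤ M) :
    ∃ b M', (d : ℝ) - 1 < 2 * b ∧ 2 * b < d ∧ 0 ≤ M' ∧
      ∀ ξ, ξ ≠ 0 → ‖measureFourier μ ξ‖ ≤ M' * ‖ξ‖ ^ (-b) := by
  have hd : (1 : ℝ) ≤ d := by exact_mod_cast Nat.one_le_iff_ne_zero.2 (NeZero.ne d)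
  -- The cap gives 2b ≤ d - 1/2, which makes |v|^{-2b} integrable at the origin. Lowering the
  -- exponent is harmless, since near 0 the total mass bounds the transform.
  set b := min β (((d : ℝ) - 1) / 2 + 1 / 4) with hb
  have hb1 : ((d : ℝ) - 1) / 2 < b := lt_min hβ (by linarith)
  have hb2 : b ≤ ((d : ℝ) - 1) / 2 + 1 / 4 := min_le_right _ _
  refine ⟨b, max M (μ.real univ), by linarith, by linarith,
    measureReal_nonneg.trans (le_max_right _ _), fun ξ hξ => ?_⟩
  have hξ0 : 0 < ‖ξ‖ := norm_pos_iff.2 hξ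
  rcases le_total 1 ‖ξ‖ with h | h
  · have h1 : ‖measureFourier μ ξ‖ ≤ M * ‖ξ‖ ^ (-β) := by
      rw [Real.rpow_neg hξ0.le, ← div_eq_mul_inv, le_div_iff₀ (by positivity)]
      exact hs ξ
    have hM : 0 ≤ M := (weightedFourier_nonneg β μ ξ).trans (hs ξ)
    refine h1.trans (mul_le_mul (le_max_left _ _) ?_ (by positivity)
      (hM.trans (le_max_left _ _)))
    exact Real.rpow_le_rpow_of_exponent_le h (neg_le_neg (min_le_left _ _))
  · refine (norm_measureFourier_le μ ξ).trans ((le_max_right M _).trans ?_)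
    refine le_mul_of_one_le_right (measureReal_nonneg.trans (le_max_right _ _)) ?_
    exact Real.one_le_rpow_of_pos_of_le_one_of_nonpos hξ0 h (by linarith)

/-- Fourier decay faster than `|ξ|^{-(d-1)/2}` is impossible for a measure living on finitely many
spheres. -/
theorem not_finite_norm_support_of_decay [NeZero d] {β M : ℝ} (hβ : ((d : ℝ) - 1) / 2 < β)
    (μ : Measure E) [IsFiniteMeasure μ] (hm : 0 < μ.real univ)
    (hs : ∀ ξ, weightedFourier β μ ξ ≤ M) : ¬ (norm '' μ.support).Finite := by
  intro hS
  obtain ⟨c, hc, hlow⟩ := exists_le_measure_close_pairs μ hm hS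
  obtain ⟨b, M', hb1, hb2, hM', hdec⟩ := exists_exponent_between hβ μ hs
  have hint := integrable_norm_rpow_gaussMeasure (d := d) (a := -(2 * b)) (by linarith)
  set J := ∫ v : E, ‖v‖ ^ (-(2 * b)) ∂(gaussMeasure d) with hJ
  have hup : ∀ ε, 0 < ε → ∫ v, ‖measureFourier μ (ε⁻¹ • v)‖ ^ 2 ∂(gaussMeasure d) ≤
      M' ^ 2 * ε ^ (2 * b) * J := by
    intro ε hε
    rw [hJ, ← integral_const_mul]
    refine integral_mono_of_nonneg (Eventually.of_forall fun v => by positivity)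
      (hint.const_mul _) ?_
    filter_upwards [ae_ne_zero_gaussMeasure] with v hv
    have hv0 : 0 < ‖v‖ := norm_pos_iff.2 hv
    have h1 := hdec (ε⁻¹ • v) (smul_ne_zero (inv_ne_zero hε.ne') hv)
    rw [norm_smul, norm_inv, Real.norm_of_nonneg hε.le,
      Real.mul_rpow (by positivity) hv0.le, Real.inv_rpow hε.le, Real.rpow_neg hε.le,
      inv_inv] at h1
    calc ‖measureFourier μ (ε⁻¹ • v)‖ ^ 2 ≤ (M' * (ε ^ b * ‖v‖ ^ (-b))) ^ 2 := by gcongr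
      _ = M' ^ 2 * (ε ^ b * ε ^ b) * (‖v‖ ^ (-b) * ‖v‖ ^ (-b)) := by ring
      _ = _ := by
        rw [← Real.rpow_add hε, ← Real.rpow_add hv0]
        ring_nf
  have hlim : Tendsto (fun ε : ℝ => M' ^ 2 * ε ^ (2 * b - ((d : ℝ) - 1)) * J) (𝓝[>] 0) (𝓝 0) := by
    have h1 := (Real.continuousAt_rpow_const 0 (2 * b - ((d : ℝ) - 1))
      (Or.inr (by linarith))).tendsto
    rw [Real.zero_rpow (by linarith)] at h1
    simpa using ((h1.mono_left nhdsWithin_le_nhds).const_mul (M' ^ 2)).mul_const J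
  have hpos : 0 < Real.exp (-Real.pi * 4) * c := by positivity
  obtain ⟨ε, hε1, hε2⟩ := ((hlim.eventually (eventually_lt_nhds hpos)).and
    (Ioo_mem_nhdsGT (zero_lt_one (α := ℝ)))).exists
  have hε0 : 0 < ε := hε2.1
  have h5 := (mul_le_mul_of_nonneg_left (hlow ε hε0 hε2.2.le)
    (Real.exp_pos (-Real.pi * 4)).le).trans ((exp_mul_close_pairs_le μ hε0).trans (hup ε hε0))
  have h6 : ε ^ (2 * b) = ε ^ (2 * b - ((d : ℝ) - 1)) * ε ^ (d - 1) := by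
    rw [← Real.rpow_natCast, Nat.cast_sub (Nat.one_le_iff_ne_zero.2 (NeZero.ne d)),
      Nat.cast_one, ← Real.rpow_add hε0, sub_add_cancel]
  rw [h6] at h5
  have h7 : 0 < ε ^ (d - 1) := by positivity
  nlinarith

end Energy

/-! ### Decay of solutions of Bessel's equation -/

section BesselODE

/-- Solutions of the radial Helmholtz equation `Ψ'' + (2k/s) Ψ' + 4π² Ψ = 0` decay like `s^{-k}`. -/
theorem exists_decay_of_radial_helmholtz {k : ℝ} {Ψ Ψ₁ Ψ₂ : ℝ → ℝ}
    (h1 : ∀ s, HasDerivAt Ψ (Ψ₁ s) s) (h2 : ∀ s, HasDerivAt Ψ₁ (Ψ₂ s) s)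
    (hode : ∀ s, s * (Ψ₂ s + 4 * Real.pi ^ 2 * Ψ s) + 2 * k * Ψ₁ s = 0) :
    ∃ K, 0 ≤ K ∧ ∀ s, 1 ≤ s → |Ψ s| ≤ K * s ^ (-k) := by
  set q : ℝ := k ^ 2 - k with hq
  -- This substitution removes the first-order term: v'' = (q/s² - 4π²)v, with w = v'.
  set v : ℝ → ℝ := fun s => s ^ k * Ψ s with hv
  set w : ℝ → ℝ := fun s => s ^ k * (Ψ₁ s + k * Ψ s / s) with hw
  have hv' : ∀ s, 0 < s → HasDerivAt v (w s) s := by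
    intro s hs
    have := (Real.hasDerivAt_rpow_const (p := k) (Or.inl hs.ne')).mul (h1 s)
    refine this.congr_deriv ?_
    rw [Real.rpow_sub_one hs.ne', hw]
    field_simp
    ring
  have hw' : ∀ s, 0 < s → HasDerivAt w ((q / s ^ 2 - 4 * Real.pi ^ 2) * v s) s := by
    intro s hs
    have := (Real.hasDerivAt_rpow_const (p := k) (Or.inl hs.ne')).mul
      ((h2 s).add (((h1 s).const_mul k).div (hasDerivAt_id s) hs.ne'))
    refine this.congr_deriv ?_
    have h3 : Ψ₂ s = -(4 * Real.pi ^ 2 * Ψ s) - 2 * k * Ψ₁ s / s := by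
      field_simp
      linear_combination hode s
    rw [Real.rpow_sub_one hs.ne', h3, hv, hq]
    simp only [id, Pi.add_apply, Pi.div_apply]
    field_simp
    ring
  -- The oscillator energy has derivative 2qvw/s², at most |q|/s² times the energy. The factor
  -- exp(|q|/s), bounded below by 1, absorbs this growth.
  set Φ : ℝ → ℝ := fun s => (w s ^ 2 + 4 * Real.pi ^ 2 * v s ^ 2) * Real.exp (|q| / s) with hΦ
  have hΦ' : ∀ s, 0 < s → HasDerivAt Φ (Real.exp (|q| / s) / s ^ 2 *
      (2 * q * v s * w s - |q| * (w s ^ 2 + 4 * Real.pi ^ 2 * v s ^ 2))) s := by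
    intro s hs
    have h3 := ((hw' s hs).pow 2).add (((hv' s hs).pow 2).const_mul (4 * Real.pi ^ 2))
    have h4 := ((hasDerivAt_const s |q|).div (hasDerivAt_id s) hs.ne').exp
    refine (h3.mul h4).congr_deriv ?_
    simp only [Pi.add_apply, Pi.pow_apply, id, Pi.div_apply]
    field_simp
    ring
  have hpi : (1 : ℝ) ≤ 4 * Real.pi ^ 2 := by nlinarith [Real.pi_gt_three]
  have hanti : AntitoneOn Φ (Ici 1) := by
    refine antitoneOn_of_hasDerivWithinAt_nonpos (convex_Ici 1)
      (f' := fun s => Real.exp (|q| / s) / s ^ 2 *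
        (2 * q * v s * w s - |q| * (w s ^ 2 + 4 * Real.pi ^ 2 * v s ^ 2)))
      (fun s hs => (hΦ' s (one_pos.trans_le hs)).continuousAt.continuousWithinAt)
      (fun s hs => ?_) fun s hs => ?_
    · exact (hΦ' s (one_pos.trans_le (interior_subset hs))).hasDerivWithinAt
    · refine mul_nonpos_of_nonneg_of_nonpos (by positivity) ?_
      have h5 : 2 * q * v s * w s ≤ |q| * (v s ^ 2 + w s ^ 2) := by
        have h6 : |2 * (v s * w s)| ≤ v s ^ 2 + w s ^ 2 :=
          abs_le.2 ⟨by nlinarith [sq_nonneg (v s + w s)], by nlinarith [sq_nonneg (v s - w s)]⟩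
        calc 2 * q * v s * w s = q * (2 * (v s * w s)) := by ring
          _ ≤ |q * (2 * (v s * w s))| := le_abs_self _
          _ = |q| * |2 * (v s * w s)| := abs_mul _ _
          _ ≤ _ := mul_le_mul_of_nonneg_left h6 (abs_nonneg q)
      nlinarith [mul_nonneg (abs_nonneg q) (mul_nonneg (sub_nonneg.2 hpi) (sq_nonneg (v s)))]
  refine ⟨Real.sqrt (Φ 1), Real.sqrt_nonneg _, fun s hs => ?_⟩
  have hs0 : 0 < s := one_pos.trans_le hs
  have h7 : v s ^ 2 ≤ Φ 1 := by
    refine le_trans ?_ (hanti self_mem_Ici hs hs)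
    have h8 : 1 ≤ Real.exp (|q| / s) := Real.one_le_exp (by positivity)
    have h9 : v s ^ 2 ≤ w s ^ 2 + 4 * Real.pi ^ 2 * v s ^ 2 := by
      nlinarith [mul_nonneg (sub_nonneg.2 hpi) (sq_nonneg (v s)), sq_nonneg (w s)]
    exact h9.trans (le_mul_of_one_le_right (by positivity) h8)
  have h10 := Real.abs_le_sqrt h7
  rw [hv, abs_mul, abs_of_pos (by positivity : 0 < s ^ k)] at h10
  rw [Real.rpow_neg hs0.le, ← div_eq_mul_inv, le_div_iff₀ (by positivity)]
  linarith

end BesselODE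

/-! ### Fourier decay of radial measures on the unit sphere -/

section SphereDecay

variable {d : ℕ}

local notation "E" => EuclideanSpace ℝ (Fin d)

theorem integral_comp_isometry {σ : Measure E} (hσ : IsRadialMeasure σ) (R : E ≃ₗᵢ[ℝ] E)
    {g : E → ℝ} (hg : Continuous g) : ∫ x, g (R x) ∂σ = ∫ x, g x ∂σ := by
  conv_rhs => rw [← hσ R]
  rw [integral_map R.continuous.aemeasurable hg.aestronglyMeasurable]

theorem IsRadialMeasure.measureFourier_eq_integral_cos {σ : Measure E} [IsFiniteMeasure σ]
    (hσ : IsRadialMeasure σ) (ξ : E) :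
    measureFourier σ ξ = ((∫ x, Real.cos (2 * Real.pi * inner ℝ x ξ) ∂σ : ℝ) : ℂ) := by
  have h1 : measureFourier σ (-ξ) = measureFourier σ ξ := hσ.measureFourier_eq (norm_neg ξ)
  have h2 : measureFourier σ ξ + measureFourier σ (-ξ) =
      2 * ((∫ x, Real.cos (2 * Real.pi * inner ℝ x ξ) ∂σ : ℝ) : ℂ) := by
    rw [measureFourier, measureFourier, ← integral_add (integrable_exp_inner σ ξ)
      (integrable_exp_inner σ (-ξ)), ← integral_complex_ofReal, ← integral_const_mul]
    refine integral_congr_ae (Eventually.of_forall fun x => ?_)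
    simp only [inner_neg_right, Complex.ofReal_cos, Complex.cos]
    push_cast
    ring_nf
  rw [h1, ← two_mul] at h2
  exact mul_left_cancel₀ two_ne_zero h2

theorem hasDerivAt_integral_of_bound (σ : Measure E) [IsFiniteMeasure σ] {F F' : ℝ → E → ℝ}
    {s₀ C C₀ : ℝ} (hF : ∀ s, Continuous (F s)) (hF' : Continuous (F' s₀))
    (hd : ∀ s x, HasDerivAt (fun s => F s x) (F' s x) s)
    (hb₀ : ∀ᵐ x ∂σ, |F s₀ x| ≤ C₀)
    (hb : ∀ᵐ x ∂σ, ∀ s ∈ Metric.ball s₀ 1, |F' s x| ≤ C) :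
    HasDerivAt (fun s => ∫ x, F s x ∂σ) (∫ x, F' s₀ x ∂σ) s₀ :=
  (hasDerivAt_integral_of_dominated_loc_of_deriv_le (Metric.ball_mem_nhds s₀ one_pos)
    (Eventually.of_forall fun s => (hF s).aestronglyMeasurable)
    (Integrable.of_bound (hF s₀).aestronglyMeasurable C₀ hb₀) hF'.aestronglyMeasurable
    hb (integrable_const C) (Eventually.of_forall fun x s _ => hd s x)).2

theorem abs_coord_le {x : E} (hx : ‖x‖ = 1) (j : Fin d) : |x j| ≤ 1 := by
  rw [← hx, ← Real.norm_eq_abs]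
  exact PiLp.norm_apply_le x j

/-- The reflection along η = e_j - u e_0 fixes the orthogonal vector ζ = e_0 + u e_j, so the
integrand ⟨x,η⟩ sin(2πs⟨x,ζ⟩) is odd under it. -/
theorem integral_reflection_eq_zero [NeZero d] {σ : Measure E} (hσ : IsRadialMeasure σ)
    {j : Fin d} (hj : j ≠ 0) (s u : ℝ) :
    ∫ x : E, (x j - u * x 0) * Real.sin (2 * Real.pi * s * (x 0 + u * x j)) ∂σ = 0 := by
  set η : E := EuclideanSpace.single j 1 - u • EuclideanSpace.single 0 1 with hη
  set ζ : E := EuclideanSpace.single 0 1 + u • EuclideanSpace.single j 1 with hζ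
  have hηx : ∀ x : E, inner ℝ x η = x j - u * x 0 := by
    intro x
    simp [hη, inner_sub_right, inner_smul_right, EuclideanSpace.inner_single_right]
  have hζx : ∀ x : E, inner ℝ x ζ = x 0 + u * x j := by
    intro x
    simp [hζ, inner_add_right, inner_smul_right, EuclideanSpace.inner_single_right]
  set R := Submodule.reflection (ℝ ∙ η)ᗮ with hR
  have hRη : R η = -η := Submodule.reflection_orthogonalComplement_singleton_eq_neg η
  have hRζ : R ζ = ζ := by
    refine Submodule.reflection_mem_subspace_eq_self ?_
    rw [Submodule.mem_orthogonal_singleton_iff_inner_left, hηx]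
    simp [hζ, hj, hj.symm]
  have hRi : ∀ x y : E, inner ℝ (R x) y = inner ℝ x (R y) := by
    intro x y
    rw [LinearIsometryEquiv.inner_map_eq_flip, hR, Submodule.reflection_symm]
  have hg : Continuous fun x : E => inner ℝ x η * Real.sin (2 * Real.pi * s * inner ℝ x ζ) := by
    fun_prop
  have h := integral_comp_isometry hσ R hg
  simp only [hRi, hRη, hRζ, inner_neg_right, neg_mul, integral_neg] at h
  simp only [← hηx, ← hζx]
  linarith

/-- The u-derivative at 0 of the preceding reflection identity; it plays the role of integration by
parts on the sphere. -/
theorem integral_coord_sq_cos [NeZero d] {σ : Measure E} [IsFiniteMeasure σ]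
    (hσ : IsRadialMeasure σ) (hone : ∀ᵐ x ∂σ, ‖x‖ = 1) {j : Fin d} (hj : j ≠ 0) (s : ℝ) :
    ∫ x : E, 2 * Real.pi * s * (x j ^ 2 * Real.cos (2 * Real.pi * s * x 0)) ∂σ =
      ∫ x : E, x 0 * Real.sin (2 * Real.pi * s * x 0) ∂σ := by
  have hder := hasDerivAt_integral_of_bound σ (s₀ := 0) (C₀ := 1)
    (C := 1 + 2 * |2 * Real.pi * s|)
    (F := fun u x => (x j - u * x 0) * Real.sin (2 * Real.pi * s * (x 0 + u * x j)))
    (F' := fun u x => -x 0 * Real.sin (2 * Real.pi * s * (x 0 + u * x j)) +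
      (x j - u * x 0) * (Real.cos (2 * Real.pi * s * (x 0 + u * x j)) *
        (2 * Real.pi * s * x j)))
    (fun u => by fun_prop) (by fun_prop) ?_ ?_ ?_
  · simp only [integral_reflection_eq_zero hσ hj] at hder
    have h0 := hder.unique (hasDerivAt_const 0 (0 : ℝ))
    simp only [zero_mul, add_zero, sub_zero] at h0
    rw [← sub_eq_zero, ← integral_sub, ← h0]
    · refine integral_congr_ae (Eventually.of_forall fun x => ?_)
      simp only
      ring
    · refine Integrable.of_bound (C := |2 * Real.pi * s|)
        (Continuous.aestronglyMeasurable (by fun_prop)) ?_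
      filter_upwards [hone] with x hx
      have h3 := abs_coord_le hx j
      rw [Real.norm_eq_abs, abs_mul (2 * Real.pi * s), abs_mul (x j ^ 2), abs_pow]
      refine mul_le_of_le_one_right (abs_nonneg _) (mul_le_one₀ (pow_le_one₀ (abs_nonneg _) h3)
        (abs_nonneg _) (Real.abs_cos_le_one _))
    · refine Integrable.of_bound (C := 1) (Continuous.aestronglyMeasurable (by fun_prop)) ?_
      filter_upwards [hone] with x hx
      rw [Real.norm_eq_abs, abs_mul]
      exact mul_le_one₀ (abs_coord_le hx 0) (abs_nonneg _) (Real.abs_sin_le_one _)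
  · intro u x
    have h1 : HasDerivAt (fun u => x j - u * x 0) (-x 0) u := by
      simpa using ((hasDerivAt_id u).mul_const (x 0)).const_sub (x j)
    have h2 : HasDerivAt (fun u => 2 * Real.pi * s * (x 0 + u * x j))
        (2 * Real.pi * s * x j) u := by
      simpa using (((hasDerivAt_id u).mul_const (x j)).const_add (x 0)).const_mul
        (2 * Real.pi * s)
    exact h1.mul h2.sin
  · filter_upwards [hone] with x hx
    simp only [zero_mul, sub_zero, abs_mul]
    exact mul_le_one₀ (abs_coord_le hx j) (abs_nonneg _) (Real.abs_sin_le_one _)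
  · filter_upwards [hone] with x hx u hu
    have hu1 : |u| ≤ 1 := by
      have := mem_ball_zero_iff.1 hu
      exact this.le
    have h0 := abs_coord_le hx 0
    have hj1 := abs_coord_le hx j
    refine (abs_add_le _ _).trans (add_le_add ?_ ?_)
    · rw [abs_mul, abs_neg]
      exact mul_le_one₀ h0 (abs_nonneg _) (Real.abs_sin_le_one _)
    · rw [abs_mul, abs_mul, abs_mul (2 * Real.pi * s)]
      have h5 : |x j - u * x 0| ≤ 2 := by
        refine (abs_sub _ _).trans ?_
        rw [abs_mul]
        have := mul_le_one₀ hu1 (abs_nonneg _) h0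
        linarith
      have h6 : |Real.cos (2 * Real.pi * s * (x 0 + u * x j))| * (|2 * Real.pi * s| * |x j|) ≤
          |2 * Real.pi * s| := by
        refine (mul_le_of_le_one_left (by positivity) (Real.abs_cos_le_one _)).trans ?_
        exact mul_le_of_le_one_right (abs_nonneg _) hj1
      exact mul_le_mul h5 h6 (by positivity) zero_le_two

/-- The Fourier transform of a radial measure on the unit sphere decays like `|ξ|^{-(d-1)/2}`. -/
theorem IsRadialMeasure.exists_integral_cos_le [NeZero d] {σ : Measure E} [IsFiniteMeasure σ]
    (hσ : IsRadialMeasure σ) (hone : ∀ᵐ x ∂σ, ‖x‖ = 1) :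
    ∃ K, 0 ≤ K ∧ ∀ s, 1 ≤ s →
      |∫ x : E, Real.cos (2 * Real.pi * s * x 0) ∂σ| ≤ K * s ^ (-(((d : ℝ) - 1) / 2)) := by
  refine exists_decay_of_radial_helmholtz
    (Ψ₁ := fun s => ∫ x : E, -Real.sin (2 * Real.pi * s * x 0) * (2 * Real.pi * x 0) ∂σ)
    (Ψ₂ := fun s => ∫ x : E, -(Real.cos (2 * Real.pi * s * x 0) * (2 * Real.pi * x 0)) *
      (2 * Real.pi * x 0) ∂σ) (fun s => ?_) (fun s => ?_) (fun s => ?_)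
  · refine hasDerivAt_integral_of_bound σ (C₀ := 1) (C := 2 * Real.pi)
      (F := fun s x => Real.cos (2 * Real.pi * s * x 0))
      (F' := fun s x => -Real.sin (2 * Real.pi * s * x 0) * (2 * Real.pi * x 0))
      (fun s => by fun_prop) (by fun_prop) (fun s x => ?_)
      (Eventually.of_forall fun x => Real.abs_cos_le_one _) ?_
    · have h2 : HasDerivAt (fun s => 2 * Real.pi * s * x 0) (2 * Real.pi * x 0) s := by
        simpa using ((hasDerivAt_id s).const_mul (2 * Real.pi)).mul_const (x 0)
      exact h2.cos
    · filter_upwards [hone] with x hx s _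
      rw [abs_mul, abs_neg, abs_mul, abs_of_pos Real.two_pi_pos]
      refine (mul_le_of_le_one_left (by positivity) (Real.abs_sin_le_one _)).trans ?_
      exact mul_le_of_le_one_right Real.two_pi_pos.le (abs_coord_le hx 0)
  · refine hasDerivAt_integral_of_bound σ (C₀ := 2 * Real.pi) (C := 2 * Real.pi * (2 * Real.pi))
      (F := fun s x => -Real.sin (2 * Real.pi * s * x 0) * (2 * Real.pi * x 0))
      (F' := fun s x => -(Real.cos (2 * Real.pi * s * x 0) * (2 * Real.pi * x 0)) *
        (2 * Real.pi * x 0))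
      (fun s => by fun_prop) (by fun_prop) (fun s x => ?_) ?_ ?_
    · have h2 : HasDerivAt (fun s => 2 * Real.pi * s * x 0) (2 * Real.pi * x 0) s := by
        simpa using ((hasDerivAt_id s).const_mul (2 * Real.pi)).mul_const (x 0)
      exact h2.sin.neg.mul_const _
    · filter_upwards [hone] with x hx
      rw [abs_mul, abs_neg, abs_mul, abs_of_pos Real.two_pi_pos]
      refine (mul_le_of_le_one_left (by positivity) (Real.abs_sin_le_one _)).trans ?_
      exact mul_le_of_le_one_right Real.two_pi_pos.le (abs_coord_le hx 0)
    · filter_upwards [hone] with x hx s _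
      have h3 : |2 * Real.pi * x 0| ≤ 2 * Real.pi := by
        rw [abs_mul, abs_of_pos Real.two_pi_pos]
        exact mul_le_of_le_one_right Real.two_pi_pos.le (abs_coord_le hx 0)
      rw [abs_mul, abs_neg, abs_mul]
      refine mul_le_mul ?_ h3 (abs_nonneg _) Real.two_pi_pos.le
      exact (mul_le_of_le_one_left (abs_nonneg _) (Real.abs_cos_le_one _)).trans h3
  · have hint : ∀ {f : E → ℝ} {C : ℝ}, Continuous f → (∀ x, ‖x‖ = 1 → |f x| ≤ C) →
        Integrable f σ := fun hf hb =>
      Integrable.of_bound hf.aestronglyMeasurable _ (hone.mono fun x hx => hb x hx)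
    have hi : ∀ j : Fin d, Integrable
        (fun x : E => 2 * Real.pi * s * (x j ^ 2 * Real.cos (2 * Real.pi * s * x 0))) σ := by
      intro j
      refine hint (C := |2 * Real.pi * s|) (by fun_prop) fun x hx => ?_
      rw [abs_mul (2 * Real.pi * s), abs_mul (x j ^ 2), abs_pow]
      exact mul_le_of_le_one_right (abs_nonneg _) (mul_le_one₀
        (pow_le_one₀ (abs_nonneg _) (abs_coord_le hx j)) (abs_nonneg _) (Real.abs_cos_le_one _))
    have hic : Integrable (fun x : E => Real.cos (2 * Real.pi * s * x 0)) σ :=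
      hint (C := 1) (by fun_prop) fun x _ => Real.abs_cos_le_one _
    -- The sum over j ≠ 0 is computed twice, by the identity for each j and by Σ x_j² = 1. Comparing
    -- the results gives the radial equation with 2k = d - 1.
    have hsum : ∑ j ∈ Finset.univ.erase (0 : Fin d),
        ∫ x : E, 2 * Real.pi * s * (x j ^ 2 * Real.cos (2 * Real.pi * s * x 0)) ∂σ =
        ((d : ℝ) - 1) * ∫ x : E, x 0 * Real.sin (2 * Real.pi * s * x 0) ∂σ := by
      rw [Finset.sum_congr rfl fun j hj =>
        integral_coord_sq_cos hσ hone (Finset.ne_of_mem_erase hj) s, Finset.sum_const,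
        Finset.card_erase_of_mem (Finset.mem_univ _), Finset.card_univ, Fintype.card_fin,
        nsmul_eq_mul, Nat.cast_sub (Nat.one_le_iff_ne_zero.2 (NeZero.ne d)), Nat.cast_one]
    have hsum2 : ∑ j ∈ Finset.univ.erase (0 : Fin d),
        ∫ x : E, 2 * Real.pi * s * (x j ^ 2 * Real.cos (2 * Real.pi * s * x 0)) ∂σ =
        (2 * Real.pi * s) * (∫ x : E, Real.cos (2 * Real.pi * s * x 0) ∂σ) -
          ∫ x : E, 2 * Real.pi * s * (x 0 ^ 2 * Real.cos (2 * Real.pi * s * x 0)) ∂σ := by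
      rw [← integral_finsetSum _ fun j _ => hi j, ← integral_const_mul,
        ← integral_sub (hic.const_mul _) (hi 0)]
      refine integral_congr_ae ?_
      filter_upwards [hone] with x hx
      have h4 : ∑ j, x j ^ 2 = 1 := by
        rw [← EuclideanSpace.real_norm_sq_eq, hx, one_pow]
      rw [← Finset.add_sum_erase _ _ (Finset.mem_univ (0 : Fin d))] at h4
      rw [← Finset.mul_sum, ← Finset.sum_mul]
      linear_combination (2 * Real.pi * s * Real.cos (2 * Real.pi * s * x 0)) * h4
    have e1 : ∫ x : E, -Real.sin (2 * Real.pi * s * x 0) * (2 * Real.pi * x 0) ∂σ =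
        -(2 * Real.pi) * ∫ x : E, x 0 * Real.sin (2 * Real.pi * s * x 0) ∂σ := by
      rw [← integral_const_mul]
      refine integral_congr_ae (Eventually.of_forall fun x => ?_)
      simp only
      ring
    have e2 : s * ∫ x : E, -(Real.cos (2 * Real.pi * s * x 0) * (2 * Real.pi * x 0)) *
        (2 * Real.pi * x 0) ∂σ = -(2 * Real.pi) *
        ∫ x : E, 2 * Real.pi * s * (x 0 ^ 2 * Real.cos (2 * Real.pi * s * x 0)) ∂σ := by
      rw [← integral_const_mul, ← integral_const_mul]
      refine integral_congr_ae (Eventually.of_forall fun x => ?_)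
      simp only
      ring
    rw [mul_add, e1, e2]
    rw [hsum] at hsum2
    linear_combination (-2 * Real.pi) * hsum2

/-- For |ξ| ≥ 1 the decay of order (d-1)/2 absorbs |ξ|^β; for |ξ| ≤ 1 the total mass suffices. -/
theorem IsRadialMeasure.exists_weightedFourier_le [NeZero d] {β : ℝ} (hβ0 : 0 < β)
    (hβ : β ≤ ((d : ℝ) - 1) / 2) {σ : Measure E} [IsFiniteMeasure σ]
    (hσ : IsRadialMeasure σ) (hone : ∀ᵐ x ∂σ, ‖x‖ = 1) :
    ∃ K, 0 ≤ K ∧ ∀ ξ, weightedFourier β σ ξ ≤ K := by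
  obtain ⟨K, hK, hdec⟩ := hσ.exists_integral_cos_le hone
  refine ⟨max K (σ.real univ), hK.trans (le_max_left _ _), fun ξ => ?_⟩
  rw [weightedFourier]
  rcases le_total ‖ξ‖ 1 with h | h
  · refine le_trans ?_ (le_max_right _ _)
    calc _ ≤ σ.real univ * 1 := mul_le_mul (norm_measureFourier_le σ ξ)
          (Real.rpow_le_one (norm_nonneg ξ) h hβ0.le) (by positivity) measureReal_nonneg
      _ = _ := mul_one _
  · refine le_trans ?_ (le_max_left _ _)
    have hξ0 : 0 < ‖ξ‖ := one_pos.trans_le h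
    have h1 : measureFourier σ ξ = ((∫ x : E, Real.cos (2 * Real.pi * ‖ξ‖ * x 0) ∂σ : ℝ) : ℂ) := by
      rw [hσ.measureFourier_eq (η := ‖ξ‖ • EuclideanSpace.single (0 : Fin d) (1 : ℝ))
        (by simp [norm_smul]), hσ.measureFourier_eq_integral_cos]
      simp [inner_smul_right, EuclideanSpace.inner_single_right, mul_assoc]
    rw [h1, Complex.norm_real, Real.norm_eq_abs]
    calc _ ≤ K * ‖ξ‖ ^ (-(((d : ℝ) - 1) / 2)) * ‖ξ‖ ^ (((d : ℝ) - 1) / 2) := by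
          refine mul_le_mul (hdec _ h) (Real.rpow_le_rpow_of_exponent_le h hβ) (by positivity)
            (by positivity)
      _ = K := by
          rw [mul_assoc, ← Real.rpow_add hξ0, neg_add_cancel, Real.rpow_zero, mul_one]

end SphereDecay

/-! ### Surface measure and the structure of radial measures -/

section Surface

variable {d : ℕ}

local notation "E" => EuclideanSpace ℝ (Fin d)

/-- The surface measure of the unit sphere, as a measure on the ambient space. -/
noncomputable def unitSurface (d : ℕ) : Measure (EuclideanSpace ℝ (Fin d)) :=
  (volume : Measure (EuclideanSpace ℝ (Fin d))).toSphere.map Subtype.val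

instance : IsFiniteMeasure (unitSurface d) := by
  unfold unitSurface
  infer_instance

theorem sphereMeasure_eq (r : ℝ≥0) :
    sphereMeasure d r = r ^ (d - 1) • (unitSurface d).map fun x => (r : ℝ) • x := by
  rw [sphereMeasure, unitSurface, Measure.map_map (by fun_prop) measurable_subtype_coe]
  rfl

theorem ae_norm_unitSurface : ∀ᵐ x ∂(unitSurface d), ‖x‖ = 1 := by
  rw [unitSurface, ae_map_iff measurable_subtype_coe.aemeasurable
    (measurableSet_eq_fun measurable_norm measurable_const)]
  exact Eventually.of_forall fun u => norm_eq_of_mem_sphere u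

theorem isRadialMeasure_unitSurface : IsRadialMeasure (unitSurface d) := by
  intro R
  ext S hS
  have hRS : MeasurableSet (R ⁻¹' S) := R.continuous.measurable hS
  rw [Measure.map_apply R.continuous.measurable hS, unitSurface,
    Measure.map_apply measurable_subtype_coe hRS, Measure.map_apply measurable_subtype_coe hS,
    Measure.toSphere_apply' _ (measurable_subtype_coe hRS),
    Measure.toSphere_apply' _ (measurable_subtype_coe hS),
    Subtype.image_preimage_coe, Subtype.image_preimage_coe]
  -- What remains compares the volumes of the cones over the two sets, and the isometry maps one
  -- cone onto the other.
  congr 1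
  refine Eq.trans ?_ (R.measurePreserving.measure_preimage_emb
    R.toHomeomorph.measurableEmbedding _)
  congr 1
  ext x
  simp only [Set.mem_smul, mem_preimage, mem_inter_iff, mem_sphere_zero_iff_norm]
  constructor
  · rintro ⟨t, ht, y, ⟨hy1, hy2⟩, rfl⟩
    exact ⟨t, ht, R y, ⟨by simpa using hy1, hy2⟩, (map_smul R t y).symm⟩
  · rintro ⟨t, ht, y, ⟨hy1, hy2⟩, hx⟩
    refine ⟨t, ht, R.symm y, ⟨by simpa using hy1, by simpa using hy2⟩, ?_⟩
    rw [← map_smul, hx, R.symm_apply_apply]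

theorem unitSurface_real_univ_pos [NeZero d] : 0 < (unitSurface d).real univ := by
  have : Nontrivial E := by
    obtain ⟨e, he⟩ := exists_unit_vector (d := d)
    exact ⟨e, 0, fun h => by simp [h] at he⟩
  have h := Measure.toSphere_ne_zero (volume : Measure E)
  rw [measureReal_def]
  refine ENNReal.toReal_pos ?_ (measure_ne_top _ _)
  rw [unitSurface, Measure.map_apply measurable_subtype_coe MeasurableSet.univ, preimage_univ]
  rwa [Ne, Measure.measure_univ_eq_zero]

/-- Averaging the Fourier transform of a radial measure over a radial measure on the unit sphere. -/
theorem IsRadialMeasure.measureFourier_mul_univ {κ σ : Measure E} [IsFiniteMeasure κ]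
    [IsFiniteMeasure σ] (hκ : IsRadialMeasure κ) (hone : ∀ᵐ x ∂σ, ‖x‖ = 1) (ξ : E) :
    measureFourier κ ξ * σ.real univ = ∫ x, measureFourier σ (‖ξ‖ • x) ∂κ := by
  rw [← integral_measureFourier_comm κ σ ‖ξ‖]
  have : ∫ ω, measureFourier κ (‖ξ‖ • ω) ∂σ = ∫ _, measureFourier κ ξ ∂σ := by
    refine integral_congr_ae ?_
    filter_upwards [hone] with ω hω
    exact hκ.measureFourier_eq (by rw [norm_smul, hω, mul_one, norm_norm])
  rw [this, integral_const, Complex.real_smul, mul_comm]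

theorem IsRadialMeasure.restrict {μ : Measure E} (hμ : IsRadialMeasure μ) {T : Set ℝ}
    (hT : MeasurableSet T) : IsRadialMeasure (μ.restrict (norm ⁻¹' T)) := by
  intro R
  have h := Measure.restrict_map (μ := μ) R.continuous.measurable
    (measurable_norm hT : MeasurableSet (norm ⁻¹' T : Set E))
  have hpre : R ⁻¹' (norm ⁻¹' T) = norm ⁻¹' T := by
    ext x
    simp
  rw [hμ R, hpre] at h
  exact h.symm

/-- When κ sits on one sphere, the integrand in the averaging formula is constant. The transform of
κ is then a multiple of that of the dilated σ, and uniqueness of the transform concludes. -/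
theorem IsRadialMeasure.eq_smul_map_of_ae_norm_eq [NeZero d] {κ σ : Measure E} [IsFiniteMeasure κ]
    [IsFiniteMeasure σ] (hκ : IsRadialMeasure κ) (hσ : IsRadialMeasure σ)
    (hone : ∀ᵐ x ∂σ, ‖x‖ = 1) (hpos : 0 < σ.real univ) {r : ℝ≥0} (hr : ∀ᵐ x ∂κ, ‖x‖ = r) :
    ∃ c : ℝ≥0, κ = c • σ.map fun x => (r : ℝ) • x := by
  obtain ⟨c, hc⟩ : ∃ c : ℝ≥0, (c : ℝ) = κ.real univ / σ.real univ :=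
    ⟨(κ.real univ / σ.real univ).toNNReal, Real.coe_toNNReal _ (by positivity)⟩
  refine ⟨c, ext_of_measureFourier fun ξ => ?_⟩
  have h1 := hκ.measureFourier_mul_univ hone ξ
  have h2 : ∫ x, measureFourier σ (‖ξ‖ • x) ∂κ = ∫ _, measureFourier σ ((r : ℝ) • ξ) ∂κ := by
    refine integral_congr_ae ?_
    filter_upwards [hr] with x hx
    refine hσ.measureFourier_eq ?_
    rw [norm_smul, norm_smul, hx, norm_norm, NNReal.norm_eq, mul_comm]
  rw [h2, integral_const, Complex.real_smul] at h1
  have hne : (σ.real univ : ℂ) ≠ 0 := by exact_mod_cast hpos.ne'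
  have hc' : (c : ℂ) = ((κ.real univ / σ.real univ : ℝ) : ℂ) := by
    rw [← hc]
  rw [measureFourier_smul, measureFourier_map_smul, hc']
  push_cast
  field_simp
  exact h1

/-- The part of a radial measure far from the origin has small weighted Fourier transform. -/
theorem exists_weightedFourier_far_le [NeZero d] {β : ℝ} (hβ0 : 0 < β)
    (hβ : β ≤ ((d : ℝ) - 1) / 2) : ∃ K, 0 ≤ K ∧ ∀ (κ : Measure E) [IsFiniteMeasure κ],
      IsRadialMeasure κ → (∀ᵐ x ∂κ, 1 ≤ ‖x‖) →
      ∀ ξ, weightedFourier β κ ξ ≤ K * κ.real univ := by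
  obtain ⟨K, hK, hdec⟩ := (isRadialMeasure_unitSurface (d := d)).exists_weightedFourier_le hβ0 hβ
    ae_norm_unitSurface
  have hpos := unitSurface_real_univ_pos (d := d)
  refine ⟨K / (unitSurface d).real univ, by positivity, fun κ _ hκ hone ξ => ?_⟩
  have h1 := hκ.measureFourier_mul_univ ae_norm_unitSurface ξ
  have h2 : ‖∫ x, measureFourier (unitSurface d) (‖ξ‖ • x) ∂κ‖ * ‖ξ‖ ^ β ≤ K * κ.real univ := by
    have h3 : ‖∫ x, (‖ξ‖ ^ β : ℝ) • measureFourier (unitSurface d) (‖ξ‖ • x) ∂κ‖ ≤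
        K * κ.real univ := by
      refine norm_integral_le_of_norm_le_const ?_
      filter_upwards [hone] with x hx
      have h4 := hdec (‖ξ‖ • x)
      rw [weightedFourier, norm_smul, norm_norm] at h4
      rw [norm_smul, Real.norm_of_nonneg (by positivity), mul_comm]
      refine le_trans ?_ h4
      refine mul_le_mul_of_nonneg_left ?_ (norm_nonneg _)
      -- Only here is |x| ≥ 1 used: the weight |ξ|^β is at most (|ξ||x|)^β, the one matching the
      -- dilated sphere.
      exact Real.rpow_le_rpow (norm_nonneg _) (le_mul_of_one_le_right (norm_nonneg _) hx) hβ0.le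
    rwa [integral_smul, norm_smul, Real.norm_of_nonneg (by positivity), mul_comm] at h3
  rw [← h1, norm_mul, Complex.norm_real, Real.norm_of_nonneg hpos.le] at h2
  rw [weightedFourier, div_mul_eq_mul_div, le_div_iff₀ hpos]
  linarith

end Surface

/-! ### Compactness of the support when β ≤ (d-1)/2 -/

section CompactSupport

variable {d : ℕ}

local notation "E" => EuclideanSpace ℝ (Fin d)

theorem exp_neg_two_mul_le {y : ℝ} (hy0 : 0 ≤ y) (hy : y ≤ 1 / 2) :
    Real.exp (-(2 * y)) ≤ 1 - y := by
  have h1 : 2 * y + 1 ≤ Real.exp (2 * y) := Real.add_one_le_exp _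
  rw [Real.exp_neg, inv_le_comm₀ (Real.exp_pos _) (by linarith)]
  refine le_trans ?_ h1
  rw [inv_le_iff_one_le_mul₀ (by linarith)]
  nlinarith

/-- Removing a piece of mass `x` whose moment is at least `A x` strictly improves the quotient
when `A` is large. -/
theorem quotient_lt_of_remove {α β M I m K A x M' I' m' : ℝ} (hα : 0 < α) (hβ : 0 < β)
    (hM : 0 < M) (hI : 0 < I) (hm : 0 < m) (hx : 0 < x) (hxm : x ≤ m / 2)
    (hA : α * K / M + 2 * (α + β) / m < β * A / I) (hM'0 : 0 ≤ M') (hM' : M' ≤ M + K * x)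
    (hI'0 : 0 ≤ I') (hI' : I' ≤ I - A * x) (hm' : m' = m - x) :
    M' ^ α * I' ^ β / m' ^ (α + β) < M ^ α * I ^ β / m ^ (α + β) := by
  have hm'0 : 0 < m' := by linarith
  -- Each factor is compared with an exponential linear in x; the comparison of exponents is then
  -- exactly `hA` times x.
  have e1 : M' ≤ M * Real.exp (K * x / M) := by
    have := Real.add_one_le_exp (K * x / M)
    calc M' ≤ M + K * x := hM'
      _ = M * (K * x / M + 1) := by field_simp; ring
      _ ≤ _ := by gcongr
  have e2 : I' ≤ I * Real.exp (-(A * x / I)) := by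
    have := Real.add_one_le_exp (-(A * x / I))
    calc I' ≤ I - A * x := hI'
      _ = I * (-(A * x / I) + 1) := by field_simp; ring
      _ ≤ _ := by gcongr
  have e3 : m * Real.exp (-(2 * (x / m))) ≤ m' := by
    have := exp_neg_two_mul_le (y := x / m) (by positivity) (by rw [div_le_iff₀ hm]; linarith)
    calc _ ≤ m * (1 - x / m) := by gcongr
      _ = m' := by rw [hm']; field_simp
  have f1 : M' ^ α ≤ M ^ α * Real.exp (K * x / M * α) := by
    rw [Real.exp_mul, ← Real.mul_rpow hM.le (Real.exp_pos _).le]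
    gcongr
  have f2 : I' ^ β ≤ I ^ β * Real.exp (-(A * x / I) * β) := by
    rw [Real.exp_mul, ← Real.mul_rpow hI.le (Real.exp_pos _).le]
    gcongr
  have f3 : m ^ (α + β) * Real.exp (-(2 * (x / m)) * (α + β)) ≤ m' ^ (α + β) := by
    rw [Real.exp_mul, ← Real.mul_rpow hm.le (Real.exp_pos _).le]
    gcongr
  have hexp : Real.exp (K * x / M * α) * Real.exp (-(A * x / I) * β) <
      Real.exp (-(2 * (x / m)) * (α + β)) := by
    rw [← Real.exp_add, Real.exp_lt_exp]
    have := mul_lt_mul_of_pos_right hA hx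
    have e : (α * K / M + 2 * (α + β) / m) * x =
      K * x / M * α + 2 * (x / m) * (α + β) := by ring
    have e' : β * A / I * x = A * x / I * β := by ring
    linarith
  rw [div_lt_div_iff₀ (by positivity) (by positivity)]
  calc M' ^ α * I' ^ β * m ^ (α + β)
      ≤ (M ^ α * Real.exp (K * x / M * α)) * (I ^ β * Real.exp (-(A * x / I) * β)) *
        m ^ (α + β) := by gcongr
    _ = M ^ α * I ^ β * (m ^ (α + β) *
        (Real.exp (K * x / M * α) * Real.exp (-(A * x / I) * β))) := by ring
    _ < M ^ α * I ^ β * (m ^ (α + β) * Real.exp (-(2 * (x / m)) * (α + β))) := by gcongr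
    _ ≤ _ := by gcongr

/-- Deleting the mass x beyond radius R raises the supremum by at most Kx, with K independent of R,
and lowers the moment by at least R^α x. For large R this contradicts optimality unless x = 0. -/
theorem IsExtremizer.isCompact_support [NeZero d] {α β M : ℝ} (hα : 0 < α) (hβ0 : 0 < β)
    (hβ : β ≤ ((d : ℝ) - 1) / 2) {μ : Measure E} [IsFiniteMeasure μ] (hrad : IsRadialMeasure μ)
    (h : IsExtremizer α β M μ) : IsCompact μ.support := by
  obtain ⟨K, hK, hfar⟩ := exists_weightedFourier_far_le (d := d) hβ0 hβ
  have hM := h.sup_pos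
  have hI := h.moment_pos
  have hm := h.mass_pos
  set I := ∫ x, ‖x‖ ^ α ∂μ with hIdef
  set m := μ.real univ with hmdef
  have ht := tendsto_rpow_atTop hα
  have ht2 : Tendsto (fun R : ℝ => β * R ^ α / I) atTop atTop :=
    (ht.const_mul_atTop hβ0).atTop_div_const hI
  -- The first condition yields x ≤ m/2 by Markov's inequality, the second is `hA` with A = R^α, and
  -- R ≥ 1 is what the far-field bound requires.
  obtain ⟨R, ⟨hR1, hR2⟩, hR3⟩ := (((ht.eventually_gt_atTop (2 * I / m)).and
    (ht2.eventually_gt_atTop (α * K / M + 2 * (α + β) / m))).and (eventually_ge_atTop 1)).exists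
  have hR0 : 0 < R := one_pos.trans_le hR3
  set μ₁ := μ.restrict (norm ⁻¹' Iic R) with hμ₁
  set μ₂ := μ.restrict (norm ⁻¹' Ioi R) with hμ₂
  have hsplit : μ = μ₁ + μ₂ := by
    have hc : (norm ⁻¹' Ioi R : Set E) = (norm ⁻¹' Iic R)ᶜ := by
      rw [← preimage_compl, compl_Iic]
    rw [hμ₁, hμ₂, hc, Measure.restrict_add_restrict_compl (measurable_norm measurableSet_Iic)]
  have hrad₂ : IsRadialMeasure μ₂ := hrad.restrict measurableSet_Ioi
  have hae : ∀ᵐ x ∂μ₂, R < ‖x‖ := ae_restrict_mem (measurable_norm measurableSet_Ioi)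
  have hI₁ : Integrable (fun x => ‖x‖ ^ α) μ₁ := h.integrable.restrict
  have hI₂ : Integrable (fun x => ‖x‖ ^ α) μ₂ := h.integrable.restrict
  have hIadd : I = (∫ x, ‖x‖ ^ α ∂μ₁) + ∫ x, ‖x‖ ^ α ∂μ₂ := by
    rw [← integral_add_measure hI₁ hI₂, ← hsplit]
  have hmadd : m = μ₁.real univ + μ₂.real univ := by
    rw [← measureReal_add_apply, ← hsplit]
  set x := μ₂.real univ with hxdef
  have hI₂ge : R ^ α * x ≤ ∫ x, ‖x‖ ^ α ∂μ₂ := by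
    have : ∫ _, R ^ α ∂μ₂ ≤ ∫ x, ‖x‖ ^ α ∂μ₂ := by
      refine integral_mono_ae (integrable_const _) hI₂ ?_
      filter_upwards [hae] with y hy
      gcongr
    rwa [integral_const, smul_eq_mul, mul_comm] at this
  have hI₁0 : 0 ≤ ∫ x, ‖x‖ ^ α ∂μ₁ := integral_nonneg fun x => by positivity
  have hx0 : 0 ≤ x := measureReal_nonneg
  have hxz : x = 0 := by
    by_contra hne
    have hxpos : 0 < x := lt_of_le_of_ne hx0 (Ne.symm hne)
    have hxm : x ≤ m / 2 := by
      rw [div_lt_iff₀ hm] at hR1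
      by_contra hc
      have hc := not_le.1 hc
      have : R ^ α * (m / 2) < R ^ α * x := by gcongr
      linarith
    have hm₁ : μ₁.real univ = m - x := by linarith
    have hμ₁0 : μ₁ ≠ 0 := by
      intro h0
      rw [h0] at hm₁
      simp at hm₁
      linarith
    have hbd : ∀ ξ, weightedFourier β μ₁ ξ ≤ M + K * x := by
      intro ξ
      have h1 := h.le_sup ξ
      have h2 := hfar μ₂ hrad₂ (hae.mono fun y hy => hR3.trans hy.le) ξ
      have h3 : weightedFourier β μ₁ ξ ≤ weightedFourier β μ ξ + weightedFourier β μ₂ ξ := by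
        have h4 : measureFourier μ₁ ξ = measureFourier μ ξ - measureFourier μ₂ ξ := by
          conv_rhs => rw [hsplit]
          rw [measureFourier_add, add_sub_cancel_right]
        simp only [weightedFourier]
        rw [← add_mul, h4]
        exact mul_le_mul_of_nonneg_right (norm_sub_le _ _) (by positivity)
      linarith
    have hM' : 0 ≤ M + K * x := by positivity
    have hopt := h.optimal μ₁ hμ₁0 _ hM' hbd hI₁
    exact absurd hopt (not_le.2 (quotient_lt_of_remove (A := R ^ α) hα hβ0 hM hI hm hxpos hxm hR2
      hM' le_rfl hI₁0 (by linarith) hm₁))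
  have hnull : μ (norm ⁻¹' Ioi R) = 0 := by
    rw [hxdef, hμ₂, measureReal_def, ENNReal.toReal_eq_zero_iff] at hxz
    simpa using hxz
  refine (isCompact_closedBall (0 : E) R).of_isClosed_subset Measure.isClosed_support ?_
  refine Measure.support_subset_of_isClosed Metric.isClosed_closedBall ?_
  rw [mem_ae_iff]
  refine measure_mono_null (fun y hy => ?_) hnull
  simpa using hy

end CompactSupport

/-! ### Absence of an atom at the origin, and the sum of spheres -/

section Decomposition

variable {d : ℕ}

local notation "E" => EuclideanSpace ℝ (Fin d)

theorem tendsto_measureFourier_smul {β M : ℝ} (hβ : 0 < β) {μ : Measure E}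
    (hs : ∀ ξ, weightedFourier β μ ξ ≤ M) {v : E} (hv : v ≠ 0) :
    Tendsto (fun L : ℝ => measureFourier μ (L • v)) atTop (𝓝 0) := by
  have hv0 : 0 < ‖v‖ := norm_pos_iff.2 hv
  have h1 : Tendsto (fun L : ℝ => M * (L * ‖v‖) ^ (-β)) atTop (𝓝 0) := by
    simpa using ((tendsto_rpow_neg_atTop hβ).comp
      (tendsto_id.atTop_mul_const hv0)).const_mul M
  refine squeeze_zero_norm' ?_ h1
  filter_upwards [eventually_gt_atTop 0] with L hL
  have h2 := hs (L • v)
  rw [weightedFourier, norm_smul, Real.norm_of_nonneg hL.le] at h2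
  rw [Real.rpow_neg (by positivity), ← div_eq_mul_inv, le_div_iff₀ (by positivity)]
  exact h2

/-- A measure whose Fourier transform decays has no atom at the origin. -/
theorem measure_singleton_zero_of_decay [NeZero d] {β M : ℝ} (hβ : 0 < β) {μ : Measure E}
    [IsFiniteMeasure μ] (hs : ∀ ξ, weightedFourier β μ ξ ≤ M) : μ {0} = 0 := by
  have hlim : Tendsto (fun L : ℝ => ∫ v, measureFourier μ (L • v) ∂(gaussMeasure d)) atTop
      (𝓝 (∫ _, (0 : ℂ) ∂(gaussMeasure d))) := by
    refine tendsto_integral_filter_of_dominated_convergence (fun _ => μ.real univ) ?_ ?_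
      (integrable_const _) ?_
    · exact Eventually.of_forall fun L =>
        ((continuous_measureFourier μ).comp (by fun_prop)).aestronglyMeasurable
    · exact Eventually.of_forall fun L => Eventually.of_forall fun v =>
        norm_measureFourier_le μ _
    · filter_upwards [ae_ne_zero_gaussMeasure] with v hv
      exact tendsto_measureFourier_smul hβ hs hv
  rw [integral_zero] at hlim
  -- The Gaussian average equals ∫ exp(-π|Lz|²) dμ, whose integrand is 1 at the origin; by decay the
  -- average tends to 0 as L grows.
  have hlow : ∀ L : ℝ, μ.real {0} ≤ ‖∫ v, measureFourier μ (L • v) ∂(gaussMeasure d)‖ := by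
    intro L
    rw [integral_measureFourier_gauss, Complex.norm_real, Real.norm_of_nonneg
      (integral_nonneg fun z => (Real.exp_pos _).le)]
    have hc : Continuous fun z : E => Real.exp (-Real.pi * ‖L • z‖ ^ 2) := by fun_prop
    have h1 : ∫ z, ({0} : Set E).indicator (fun _ => (1 : ℝ)) z ∂μ ≤
        ∫ z, Real.exp (-Real.pi * ‖L • z‖ ^ 2) ∂μ := by
      refine integral_mono ((integrable_const _).indicator (measurableSet_singleton _)) ?_ ?_
      · refine Integrable.of_bound (C := 1) hc.aestronglyMeasurable
          (Eventually.of_forall fun z => ?_)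
        rw [Real.norm_eq_abs, Real.abs_exp, Real.exp_le_one_iff]
        have := Real.pi_pos
        nlinarith [sq_nonneg ‖L • z‖]
      · intro z
        by_cases hz : z = 0
        · simp [hz]
        · rw [indicator_of_notMem (by simpa using hz)]
          positivity
    rwa [integral_indicator_const _ (measurableSet_singleton _), smul_eq_mul, mul_one] at h1
  have h2 : μ.real {0} ≤ 0 := by
    have h3 := hlim.norm
    rw [norm_zero] at h3
    exact ge_of_tendsto' h3 hlow
  have h4 := le_antisymm h2 measureReal_nonneg
  rwa [measureReal_eq_zero_iff] at h4

theorem exists_nat_indexed_sum (S : Finset ℝ≥0) (c : ℝ≥0 → ℝ≥0) :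
    ∃ (N : ℕ) (c' r : ℕ → ℝ≥0), ∑ s ∈ S, c s • sphereMeasure d s =
      ∑ k ∈ Finset.range (N + 1), c' k • sphereMeasure d (r k) := by
  classical
  induction S using Finset.induction_on with
  -- The range N + 1 is never empty, so the empty sum is written as one term with coefficient 0.
  | empty => exact ⟨0, 0, 0, by simp⟩
  | insert a S ha ih =>
    obtain ⟨N, c', r, hN⟩ := ih
    refine ⟨N + 1, Function.update c' (N + 1) (c a), Function.update r (N + 1) a, ?_⟩
    rw [Finset.sum_insert ha, Finset.sum_range_succ, hN, Function.update_self,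
      Function.update_self, add_comm]
    congr 1
    refine Finset.sum_congr rfl fun k hk => ?_
    have hk : k ≠ N + 1 := (Finset.mem_range.1 hk).ne
    rw [Function.update_of_ne hk, Function.update_of_ne hk]

theorem eq_sum_restrict_of_norm_mem {μ : Measure E} {S : Finset ℝ≥0}
    (hS : ∀ᵐ x ∂μ, ‖x‖₊ ∈ S) :
    μ = ∑ s ∈ S, μ.restrict (norm ⁻¹' {(s : ℝ)}) := by
  have hdisj : Pairwise (Function.onFun Disjoint
      fun s : S => (norm ⁻¹' {((s : ℝ≥0) : ℝ)} : Set E)) := by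
    intro s t hst
    refine Disjoint.preimage _ (disjoint_singleton.2 fun h => hst ?_)
    exact Subtype.ext (by exact_mod_cast h)
  have hun : ∀ᵐ x ∂μ, x ∈ ⋃ s : S, (norm ⁻¹' {((s : ℝ≥0) : ℝ)} : Set E) := by
    filter_upwards [hS] with x hx
    exact mem_iUnion.2 ⟨⟨‖x‖₊, hx⟩, by simp⟩
  have h := Measure.restrict_iUnion (μ := μ) hdisj
    fun s => measurable_norm (measurableSet_singleton _)
  rw [Measure.restrict_eq_self_of_ae_mem hun, Measure.sum_fintype] at h
  rw [Finset.sum_coe_sort S fun s => μ.restrict (norm ⁻¹' {(s : ℝ)})] at h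
  exact h

/-- A radial measure on finitely many spheres without an atom at the origin is a finite sum of
multiples of the uniform measures of those spheres. -/
theorem IsRadialMeasure.exists_eq_sum_sphereMeasure [NeZero d] {μ : Measure E} [IsFiniteMeasure μ]
    (hμ : IsRadialMeasure μ) (hfin : (norm '' μ.support).Finite) (h0 : μ {0} = 0) :
    ∃ (N : ℕ) (c r : ℕ → ℝ≥0),
      μ = ∑ k ∈ Finset.range (N + 1), c k • sphereMeasure d (r k) := by
  classical
  have hfin' : ((fun x : E => ‖x‖₊) '' μ.support).Finite := by
    refine Set.Finite.of_finite_image (f := ((↑) : ℝ≥0 → ℝ)) ?_ NNReal.coe_injective.injOn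
    rwa [image_image]
  have hS : ∀ᵐ x ∂μ, ‖x‖₊ ∈ hfin'.toFinset := by
    filter_upwards [Measure.support_mem_ae (μ := μ)] with x hx
    exact hfin'.mem_toFinset.2 ⟨x, hx, rfl⟩
  have hpiece : ∀ s : ℝ≥0, ∃ c : ℝ≥0,
      μ.restrict (norm ⁻¹' {(s : ℝ)}) = c • sphereMeasure d s := by
    intro s
    -- Radius 0 is separate: for d ≥ 2 the factor r^{d-1} makes `sphereMeasure d 0` zero, so an atom
    -- at the origin could not be represented.
    rcases eq_or_ne s 0 with rfl | hs
    · refine ⟨0, ?_⟩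
      rw [zero_smul, Measure.restrict_eq_zero]
      refine measure_mono_null (fun x hx => ?_) h0
      simpa using hx
    · obtain ⟨c, hc⟩ := (hμ.restrict (measurableSet_singleton (s : ℝ))).eq_smul_map_of_ae_norm_eq
        isRadialMeasure_unitSurface ae_norm_unitSurface unitSurface_real_univ_pos
        (ae_restrict_mem (measurable_norm (measurableSet_singleton _)))
      refine ⟨c / s ^ (d - 1), ?_⟩
      rw [hc, sphereMeasure_eq, smul_smul, div_mul_cancel₀ _ (pow_ne_zero _ hs)]
  choose c hc using hpiece
  obtain ⟨N, c', r, h⟩ := exists_nat_indexed_sum (d := d) hfin'.toFinset c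
  refine ⟨N, c', r, ?_⟩
  rw [← h, ← Finset.sum_congr rfl fun s _ => hc s]
  exact eq_sum_restrict_of_norm_mem hS

end Decomposition

theorem IsExtremizer.attains_or_finite_norm_support {d : ℕ} [NeZero d] {α β M : ℝ} (hα : 0 < α)
    (hβ : 0 < β) {μ : Measure (EuclideanSpace ℝ (Fin d))} [IsFiniteMeasure μ]
    (hrad : IsRadialMeasure μ) (h : IsExtremizer α β M μ) :
    AttainsSupAtInfinity β μ ∨ (norm '' μ.support).Finite := by
  refine or_iff_not_imp_left.2 fun hnot => ?_
  rw [AttainsSupAtInfinity] at hnot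
  push Not at hnot
  obtain ⟨Δ, hΔ0, hΔ⟩ := hnot
  -- Non-attainment is known only for |ξ| > Δ, whereas a closed condition is needed; hence Δ + 1.
  refine h.finite_norm_support (Δ := Δ + 1) hα hβ hrad (by linarith) fun ξ hξ => ?_
  refine lt_of_le_of_ne (h.le_sup ξ) fun heq => hΔ ξ (by linarith) ?_
  rw [h.sup_eq, heq]

theorem mainTheorem3 (d : ℕ) (hd : 1 ≤ d) (α β : ℝ) (hα : 0 < α) (hβ : 0 < β)
    (μ : Measure (EuclideanSpace ℝ (Fin d))) [IsFiniteMeasure μ] (hμ : μ ≠ 0)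
    (hrad : IsRadialMeasure μ)
    (hext : uncertaintyQuotient α β μ = optimalConstant d α β) :
    (((d : ℝ) - 1) / 2 < β → AttainsSupAtInfinity β μ) ∧
    (β ≤ ((d : ℝ) - 1) / 2 →
      IsCompact μ.support ∧
      (AttainsSupAtInfinity β μ ∨
        ∃ (N : ℕ) (c r : ℕ → ℝ≥0),
          μ = ∑ k ∈ Finset.range (N + 1), c k • sphereMeasure d (r k))) := by
  have : NeZero d := ⟨Nat.one_le_iff_ne_zero.1 hd⟩
  obtain ⟨M, h⟩ := exists_isExtremizer hα hβ hμ hext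
  have hdich := h.attains_or_finite_norm_support hα hβ hrad
  refine ⟨fun hlt => hdich.resolve_right ?_, fun hle => ⟨h.isCompact_support hα hβ hle hrad, ?_⟩⟩
  · exact not_finite_norm_support_of_decay hlt μ h.mass_pos h.le_sup
  · exact hdich.imp_right fun hfin => hrad.exists_eq_sum_sphereMeasure hfin
      (measure_singleton_zero_of_decay hβ h.le_sup)
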